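/- A *simple plane triangulation* is a finite connected simple graph embedded in the sphere such that every face is bounded by a 3-cycle (the triangle $K_3$, with two faces, is allowed). It is *Eulerian* if all its vertices have even degree; the faces of an Eulerian plane triangulation can be properly colored red and blue. A 3-cycle is *separating* if each of the two regions of its complement contains at least one vertex. If $T_1,T_2$ are simple plane triangulations with faces $f_1,f_2$, *pasting* $f_1$ and $f_2$ means identifying the boundaries of $f_1$ and $f_2$ (the three vertices being matched in any of the six ways); the faces of the result are the faces of $T_1$ other than $f_1$ and those of $T_2$ other than $f_2$. Define classes $\mathcal T_0=\emptyset$ and $\mathcal T_1\subseteq\mathcal T_2\subseteq\cdots$ of simple plane triangulations with a distinguished face recursively: for $i\ge 1$, $(T,f)\in\mathcal T_i$ if $T$ is (up to isomorphism) constructed from some simple plane Eulerian triangulation $E$ without separating 3-cycles, having $f$ as a face and with its faces properly colored red and blue so that $f$ is red, by pasting simultaneously - onto each red face of $E$ other than $f$ an arbitrary simple plane triangulation along one of its faces, or nothing; and - onto each blue face $b$ of $E$ a simple plane triangulation $B$ along a face $b'$ of $B$ with $(B,b')\in\mathcal T_{i-1}$, or nothing. $T$ is *quasi-Eulerian with respect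 to $f$* if $(T,f)\in\bigcup_{i\ge1}\mathcal T_i$. A *2-coloring* is a (not necessarily proper) coloring of vertices with black and white; a face is *monochromatic* if its vertices all receive the same color; a 2-coloring of $T$ is *near-weak* if exactly one face of $T$ is monochromatic. **Lemma.** Let $T$ be a simple plane triangulation and let $f$ be a face of $T$. (i) A monochromatic 2-coloring of (the three vertices of) $f$ can be extended to a near-weak 2-coloring of $T$ if and only if $T$ is not quasi-Eulerian with respect to $f$. (ii) If $T$ is quasi-Eulerian with respect to $f$, then any monochromatic 2-coloring of $f$ can be extended to a 2-coloring of $T$ such that exactly two faces of $T$ are monochromatic. -/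

import Mathlib

universe u

/-- A rotation system on a simple graph: a permutation `rot` of the darts (oriented edges) that
permutes cyclically the darts leaving each vertex.  This is the standard combinatorial description
of a cellular embedding of the graph in an oriented closed surface. -/
structure RotationSystem (V : Type u) where
  graph : SimpleGraph V
  rot : Equiv.Perm graph.Dart
  rot_fst : ∀ d, (rot d).fst = d.fst
  rot_cyclic : ∀ d e : graph.Dart, d.fst = e.fst → rot.SameCycle d e

namespace RotationSystem

variable {V : Type u} (M : RotationSystem V)

/-- The face permutation: from the dart `(a, b)` go to the dart that follows `(b, a)` in the
rotation at `b`.  It traverses the boundary walks of the faces. -/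
def faceNext : Equiv.Perm M.graph.Dart :=
  (SimpleGraph.Dart.symm_involutive (G := M.graph)).toPerm.trans M.rot

/-- The faces are the cycles of the face permutation. -/
def Face : Type u := Quotient (Equiv.Perm.SameCycle.setoid M.faceNext)

/-- The face on whose boundary walk the dart `d` lies. The two sides of the edge of `d` are
`M.face d` and `M.face d.symm`. -/
def face (d : M.graph.Dart) : M.Face := Quotient.mk _ d

/-- The vertices on the boundary of a face. -/
def faceVerts (p : M.Face) : Set V := {v | ∃ d : M.graph.Dart, M.face d = p ∧ d.fst = v}

end RotationSystem

/-- A simple plane triangulation on the (finite) vertex set `V`: a connected simple graph, cellularly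
embedded in the sphere (Euler's formula), such that every face is bounded by a 3-cycle.
The graph being simple, `faceNext` has no cycle of length 1, so `triangular` says that every
face has length exactly 3.  The smallest example is the triangle `K₃`, with two faces. -/
structure PlaneTriangulation (V : Type u) [Finite V] extends RotationSystem V where
  connected : graph.Connected
  euler : Nat.card V + Nat.card toRotationSystem.Face = Nat.card graph.edgeSet + 2
  triangular : ∀ d : graph.Dart,
    toRotationSystem.faceNext (toRotationSystem.faceNext (toRotationSystem.faceNext d)) = d

/-- The two colors of vertices. -/
inductive VertexColor : Type
  | black
  | white

/-- The two colors of faces of Eulerian triangulations. -/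
inductive FaceColor : Type
  | red
  | blue

namespace PlaneTriangulation

variable {V : Type u} [Finite V] (T : PlaneTriangulation V)

/-- Every vertex has even degree (a triangulation is connected by definition). -/
def Eulerian : Prop := ∀ v : V, Even (T.graph.neighborSet v).ncard

/-- Two faces lie in the same region of the complement of the edge set `C` if one can get from one
to the other by repeatedly crossing edges that are not in `C`. -/
def SameRegion (C : Set (Sym2 V)) : T.Face → T.Face → Prop :=
  Relation.EqvGen fun p q => ∃ d : T.graph.Dart, d.edge ∉ C ∧ T.face d = p ∧ T.face d.symm = q

/-- `a`, `b`, `c` form a separating 3-cycle: both regions (inner and outer) of its complement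
contain a vertex.  A vertex `x` off the cycle lies in the region of the faces incident with `x`. -/
def IsSeparatingTriangle (a b c : V) : Prop :=
  T.graph.Adj a b ∧ T.graph.Adj b c ∧ T.graph.Adj c a ∧
    ∃ x y : V, x ∉ ({a, b, c} : Set V) ∧ y ∉ ({a, b, c} : Set V) ∧
      ∃ p q : T.Face, x ∈ T.faceVerts p ∧ y ∈ T.faceVerts q ∧
        ¬ T.SameRegion {s(a, b), s(b, c), s(c, a)} p q

/-- A face coloring is proper if the two faces on the two sides of each edge differ in color. -/
def IsProperFaceColoring (ψ : T.Face → FaceColor) : Prop :=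
  ∀ d : T.graph.Dart, ψ (T.face d) ≠ ψ (T.face d.symm)

/-- A face is monochromatic in the (not necessarily proper) vertex coloring `c` if its vertices
receive only one color. -/
def IsMonochromatic (c : V → VertexColor) (p : T.Face) : Prop :=
  ∃ k : VertexColor, ∀ v ∈ T.faceVerts p, c v = k

/-- The set of monochromatic faces of a vertex coloring. -/
def monochromaticFaces (c : V → VertexColor) : Set T.Face := {p | T.IsMonochromatic c p}

/-- A 2-coloring is near-weak if exactly one face is monochromatic. -/
def IsNearWeak (c : V → VertexColor) : Prop := (T.monochromaticFaces c).ncard = 1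

end PlaneTriangulation

/-- A simple plane triangulation together with a distinguished face. -/
structure RootedTriangulation : Type (u + 1) where
  V : Type u
  [fin : Finite V]
  tri : PlaneTriangulation V
  root : tri.Face

attribute [instance] RootedTriangulation.fin

/-- `Pasting T E` says that (up to isomorphism) the triangulation `T` is constructed from `E` by
pasting plane triangulations onto some of the faces of `E`: onto each face `g` in the set `pasted`
a triangulation `piece g` is pasted by identifying `g` with the root face of `piece g`, and onto
the remaining faces nothing is pasted ("the pasted triangulation is empty").
The three vertices of the root face may be matched with those of `g` in any of the six ways;
accordingly, faces are compared through their vertex sets, not through their orientations. -/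
structure Pasting {V W : Type u} [Finite V] [Finite W]
    (T : PlaneTriangulation V) (E : PlaneTriangulation W) : Type (u + 1) where
  /-- The faces of `E` onto which a nonempty triangulation is pasted. -/
  pasted : Set E.Face
  /-- The triangulations pasted onto these faces, rooted at the faces used for pasting. -/
  piece : pasted → RootedTriangulation.{u}
  /-- The vertices of `E` as vertices of `T`. -/
  incl : W ↪ V
  /-- The vertices of the pieces as vertices of `T`. -/
  pieceIncl : ∀ g : pasted, (piece g).V ↪ V
  /-- The root face of a piece is identified with the face onto which the piece is pasted. -/
  glue : ∀ g : pasted,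
    pieceIncl g '' (piece g).tri.faceVerts (piece g).root = incl '' E.faceVerts g
  /-- A piece meets `E` only in the three identified vertices. -/
  inter_skeleton : ∀ g : pasted,
    Set.range (pieceIncl g) ∩ Set.range incl = incl '' E.faceVerts g
  /-- Distinct pieces meet only in vertices of `E`. -/
  inter_piece : ∀ g h : pasted, g ≠ h →
    Set.range (pieceIncl g) ∩ Set.range (pieceIncl h) ⊆ Set.range incl
  /-- The faces of `T` are the faces of `E` onto which nothing is pasted and the non-root faces of
  the pieces (as every vertex and every edge lies on a face, this determines `T`). -/
  faceEquiv : ({p : E.Face // p ∉ pasted} ⊕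
    (Σ g : pasted, {p : (piece g).tri.Face // p ≠ (piece g).root})) ≃ T.Face
  faceVerts_inl : ∀ p, T.faceVerts (faceEquiv (Sum.inl p)) = incl '' E.faceVerts p.1
  faceVerts_inr : ∀ g p,
    T.faceVerts (faceEquiv (Sum.inr ⟨g, p⟩)) = pieceIncl g '' (piece g).tri.faceVerts p.1

/-- The class `𝒯ₙ` of rooted triangulations; `𝒯₀` is empty.  A triangulation with root face `f`
is in `𝒯ₙ₊₁` if it is constructed from an Eulerian triangulation `E` without separating 3-cycles,
having `f` as a face, whose faces are properly colored red and blue with `f` red, by pasting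
arbitrary (possibly empty) plane triangulations onto the red faces other than `f` and
(possibly empty) members of `𝒯ₙ` onto the blue faces.  In particular all blue faces remain
untouched for `𝒯₁`. -/
def QuasiEulerianClass : ℕ → RootedTriangulation.{u} → Prop
  | 0, _ => False
  | n + 1, T =>
    ∃ (E : RootedTriangulation.{u}) (ψ : E.tri.Face → FaceColor) (P : Pasting T.tri E.tri),
      E.tri.Eulerian ∧
      (∀ a b c : E.V, ¬ E.tri.IsSeparatingTriangle a b c) ∧
      E.tri.IsProperFaceColoring ψ ∧
      ψ E.root = FaceColor.red ∧
      (∃ h : E.root ∉ P.pasted, P.faceEquiv (Sum.inl ⟨E.root, h⟩) = T.root) ∧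
      ∀ g : P.pasted, ψ g = FaceColor.blue → QuasiEulerianClass n (P.piece g)

/-- `T` is quasi-Eulerian with respect to its face `f`: it lies in the union of the `𝒯ₙ`. -/
def PlaneTriangulation.QuasiEulerian {V : Type u} [Finite V] (T : PlaneTriangulation V)
    (f : T.Face) : Prop :=
  ∃ n : ℕ, QuasiEulerianClass n { V := V, tri := T, root := f }

/-!
# Near-weak colorings of rooted plane triangulations

In a 2-coloring of the vertices, every face has one or three monochromatic edges.  Conversely, on
the sphere every set of edges with one or three members on each face is the set of monochromatic
edges of a 2-coloring (`exists_coloring`): its complement is a cocycle modulo 2, and by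
Euler's formula the first cohomology vanishes (`Triangular.euler_iff`).  Hence a coloring
whose only monochromatic face is `f` is a perfect matching of the dual cubic graph minus `f` and
its three neighbors.

Call a set of faces tight if every coloring that is constant on its boundary makes one of its faces
monochromatic.  The heart of the matter is that `T` is quasi-Eulerian with respect to `f` if and
only if the complement of `f` is tight (`quasiEulerian_iff_tight`).

* Quasi-Eulerian implies tight.  In an Eulerian triangulation whose faces are colored red and
  blue, count monochromatic edges by red and by blue faces: if a red face is monochromatic, then so
  is some blue face (`IsProperFaceColoring.exists_blue_monochromatic`), and in a blue face with a
  piece pasted onto it one continues by induction.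

* Tight implies quasi-Eulerian.  As the matching does not exist, Tutte's theorem gives a set `S`
  of faces, containing the neighbors of `f`, and at least as many disjoint sets `K i`, one of them
  `{f}`, without edges between each other.  Each `K i` has at least three edges to `S`, so that
  all of them have exactly three, and `S` and the `K i` exhaust the faces in a bipartite way
  (`isBarrier_of_ncard_le`).  Contracting each `K i` to a face gives an Eulerian triangulation in
  which the `K i` are red and the members of `S` blue.  If it has a separating triangle, one
  contracts the side that avoids `f` to a single face, which is tight if it is blue
  (`Admissible.exists_ncard_lt`).  When this process ends, `T` is a pasting of smaller
  triangulations onto the contraction, the ones on blue faces being quasi-Eulerian by induction.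

The contraction is a single construction (`TriangularParts.contract`): given a partition of the
faces into parts bounded by 3-cycles, the edges between different parts form a plane
triangulation, with the parts as its faces.  The pieces are contractions as well.

For the second claim let `g` be a neighbor of `f`, and join the other two neighbors `a`, `b` of `g`
by an additional edge before applying Tutte's theorem.  A barrier would have `a` and `b`
in the same part, and this part together with `g` would be bounded by only two edges.  So there is
a matching; if it uses the additional edge, it translates into a coloring with exactly
`f` and `g` monochromatic, and otherwise only `f` is monochromatic (`exists_coloring_le_two`).
-/

/-! ### Boundaries of sets of faces -/

namespace RotationSystem

variable {V : Type u} (M : RotationSystem V)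

lemma faceNext_apply (d : M.graph.Dart) : M.faceNext d = M.rot d.symm := rfl

lemma rot_eq_faceNext_symm (d : M.graph.Dart) : M.rot d = M.faceNext d.symm := by
  simp [faceNext_apply]

@[simp] lemma faceNext_fst (d : M.graph.Dart) : (M.faceNext d).fst = d.snd :=
  M.rot_fst d.symm

@[simp] lemma face_faceNext (d : M.graph.Dart) : M.face (M.faceNext d) = M.face d :=
  Quotient.sound (Equiv.Perm.sameCycle_apply_left.2 (Equiv.Perm.SameCycle.refl _ _))

lemma face_rot (d : M.graph.Dart) : M.face (M.rot d) = M.face d.symm := by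
  rw [rot_eq_faceNext_symm, face_faceNext]

lemma face_eq_iff (d e : M.graph.Dart) : M.face d = M.face e ↔ M.faceNext.SameCycle d e :=
  Quotient.eq (r := Equiv.Perm.SameCycle.setoid M.faceNext)

lemma exists_face_eq (p : M.Face) : ∃ d, M.face d = p := Quotient.exists_rep p

lemma dart_ext {d e : M.graph.Dart} (h₁ : d.fst = e.fst) (h₂ : d.snd = e.snd) : d = e :=
  SimpleGraph.Dart.ext _ _ (Prod.ext h₁ h₂)

instance [Finite V] : Finite M.graph.Dart :=
  Finite.of_injective _ SimpleGraph.Dart.toProd_injective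

instance [Finite V] : Finite M.Face := Finite.of_surjective M.face M.exists_face_eq

/-- A set of darts at a vertex that is closed under the rotation and nonempty contains all darts
at the vertex. -/
lemma mem_of_rot_closed [Finite V] {s : Set M.graph.Dart} {v : V}
    (hs : ∀ d ∈ s, d.fst = v → M.rot d ∈ s) {d e : M.graph.Dart} (hd : d ∈ s)
    (hdv : d.fst = v) (hev : e.fst = v) : e ∈ s := by
  obtain ⟨n, -, rfl⟩ := (M.rot_cyclic d e (hdv.trans hev.symm)).exists_pow_eq'
  have : ∀ n : ℕ, ((M.rot ^ n) d) ∈ s ∧ ((M.rot ^ n) d).fst = v := by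
    intro n
    induction n with
    | zero => exact ⟨hd, hdv⟩
    | succ n ih =>
      rw [pow_succ', Equiv.Perm.mul_apply]
      exact ⟨hs _ ih.1 ih.2, (M.rot_fst _).trans ih.2⟩
  exact (this n).1

/-- The boundary of a set of faces: the darts that run along a face of the set and have a face
outside the set on their other side. -/
def bd (A : Set M.Face) : Set M.graph.Dart := {d | M.face d ∈ A ∧ M.face d.symm ∉ A}

variable {M}

lemma mem_bd {A : Set M.Face} {d : M.graph.Dart} :
    d ∈ M.bd A ↔ M.face d ∈ A ∧ M.face d.symm ∉ A := Iff.rfl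

lemma symm_mem_bd_compl {A : Set M.Face} {d : M.graph.Dart} :
    d.symm ∈ M.bd Aᶜ ↔ d ∈ M.bd A := by
  simp [mem_bd, and_comm]

lemma bd_compl (A : Set M.Face) : M.bd Aᶜ = SimpleGraph.Dart.symm '' M.bd A := by
  ext d
  constructor
  · intro h
    exact ⟨d.symm, by simpa using symm_mem_bd_compl (A := Aᶜ).2 h, d.symm_symm⟩
  · rintro ⟨e, he, rfl⟩
    exact symm_mem_bd_compl.2 he

lemma ncard_bd_compl (A : Set M.Face) : (M.bd Aᶜ).ncard = (M.bd A).ncard := by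
  rw [bd_compl]
  exact Set.ncard_image_of_injective _ SimpleGraph.Dart.symm_involutive.injective

/-- A vertex that is incident with a face of `A` and with a face outside `A` has an outgoing
boundary dart. -/
lemma exists_mem_bd_of_fst_eq [Finite V] {A : Set M.Face} {d e : M.graph.Dart}
    (h : d.fst = e.fst) (hd : M.face d ∈ A) (he : M.face e ∉ A) :
    ∃ b ∈ M.bd A, b.fst = d.fst := by
  by_contra! hcon
  refine he (M.mem_of_rot_closed (s := {x | M.face x ∈ A}) (v := d.fst) ?_ hd rfl h.symm)
  intro x hx hxv
  by_contra hxA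
  refine hcon x ⟨hx, ?_⟩ hxv
  simpa [face_rot] using hxA

/-- Every boundary dart has a successor along the boundary. -/
lemma exists_bd_succ [Finite V] {A : Set M.Face} {d : M.graph.Dart} (hd : d ∈ M.bd A) :
    ∃ e ∈ M.bd A, e.fst = d.snd := by
  obtain ⟨b, hb, h⟩ := exists_mem_bd_of_fst_eq (A := A) (d := M.faceNext d) (e := d.symm)
    (by simp) (by simpa using hd.1) hd.2
  exact ⟨b, hb, by simpa using h⟩

lemma snd_ne_of_mem_bd {A : Set M.Face} {d e : M.graph.Dart} (hd : d ∈ M.bd A)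
    (he : e ∈ M.bd A) (h : e.fst = d.snd) : e.snd ≠ d.fst := by
  intro h'
  have : e = d.symm := M.dart_ext h h'
  exact hd.2 (this ▸ he.1)

/-- A nonempty boundary contains a directed path of length three. -/
lemma exists_bd_path [Finite V] {A : Set M.Face} {d : M.graph.Dart} (hd : d ∈ M.bd A) :
    ∃ e ∈ M.bd A, ∃ g ∈ M.bd A, e.fst = d.snd ∧ g.fst = e.snd ∧ e.snd ≠ d.fst ∧
      g.snd ≠ e.fst := by
  obtain ⟨e, he, h₁⟩ := exists_bd_succ hd
  obtain ⟨g, hg, h₂⟩ := exists_bd_succ he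
  exact ⟨e, he, g, hg, h₁, h₂, snd_ne_of_mem_bd hd he h₁, snd_ne_of_mem_bd he hg h₂⟩

lemma three_le_ncard_bd_of_nonempty [Finite V] {A : Set M.Face} (h : (M.bd A).Nonempty) :
    3 ≤ (M.bd A).ncard := by
  obtain ⟨d, hd⟩ := h
  obtain ⟨e, he, g, hg, h₁, h₂, h₃, -⟩ := exists_bd_path hd
  have hde : d ≠ e := fun h => d.fst_ne_snd (h ▸ h₁)
  have heg : e ≠ g := fun h => e.fst_ne_snd (h ▸ h₂)
  have hdg : d ≠ g := fun h => h₃ (h ▸ h₂.symm)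
  have : ({d, e, g} : Set M.graph.Dart).ncard = 3 :=
    Set.ncard_eq_three.2 ⟨d, e, g, hde, hdg, heg, rfl⟩
  rw [← this]
  refine Set.ncard_le_ncard ?_ (Set.toFinite _)
  rintro x (rfl | rfl | rfl) <;> assumption

/-- A boundary of three darts is a directed 3-cycle. -/
lemma bd_eq_triangle [Finite V] {A : Set M.Face} (h : (M.bd A).ncard = 3) {d : M.graph.Dart}
    (hd : d ∈ M.bd A) :
    ∃ e g : M.graph.Dart, M.bd A = {d, e, g} ∧ e.fst = d.snd ∧ g.fst = e.snd ∧ g.snd = d.fst ∧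
      e.snd ≠ d.fst := by
  obtain ⟨e, he, g, hg, h₁, h₂, h₃, h₄⟩ := exists_bd_path hd
  have hde : d ≠ e := fun h => d.fst_ne_snd (h ▸ h₁)
  have heg : e ≠ g := fun h => e.fst_ne_snd (h ▸ h₂)
  have hdg : d ≠ g := fun h => h₃ (h ▸ h₂.symm)
  have hc : ({d, e, g} : Set M.graph.Dart).ncard = 3 :=
    Set.ncard_eq_three.2 ⟨d, e, g, hde, hdg, heg, rfl⟩
  have heq : {d, e, g} = M.bd A := by
    refine Set.eq_of_subset_of_ncard_le ?_ (by rw [hc, h]) (Set.toFinite _)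
    rintro x (rfl | rfl | rfl) <;> assumption
  refine ⟨e, g, heq.symm, h₁, h₂, ?_, h₃⟩
  obtain ⟨x, hx, hx'⟩ := exists_bd_succ hg
  rw [← heq] at hx
  rcases hx with rfl | rfl | rfl
  · exact hx'.symm
  · exact absurd hx'.symm h₄
  · exact absurd hx' x.fst_ne_snd

lemma bd_fst_injOn [Finite V] {A : Set M.Face} (h : (M.bd A).ncard = 3) :
    Set.InjOn (fun d : M.graph.Dart => d.fst) (M.bd A) := by
  intro d hd x hx hdx
  obtain ⟨e, g, heq, h₁, h₂, h₃, h₄⟩ := bd_eq_triangle h hd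
  rw [heq] at hx
  change d.fst = x.fst at hdx
  rcases hx with rfl | rfl | rfl
  · rfl
  · exact absurd (hdx.trans h₁) d.fst_ne_snd
  · exact absurd (hdx.trans h₂) h₄.symm

/-- A nonempty set of faces without boundary contains all faces. -/
lemma eq_univ_of_bd_eq_empty [Finite V] (hconn : M.graph.Connected) {A : Set M.Face}
    (hA : A.Nonempty) (h : M.bd A = ∅) : A = Set.univ := by
  have hcl : ∀ d : M.graph.Dart, M.face d ∈ A → M.face d.symm ∈ A := by
    intro d hd
    by_contra hd'
    exact (Set.eq_empty_iff_forall_notMem.1 h d) ⟨hd, hd'⟩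
  have hv : ∀ d e : M.graph.Dart, d.fst = e.fst → M.face d ∈ A → M.face e ∈ A := by
    intro d e hde hd
    by_contra he
    obtain ⟨b, hb, -⟩ := exists_mem_bd_of_fst_eq hde hd he
    rw [h] at hb
    exact hb
  obtain ⟨p, hp⟩ := hA
  obtain ⟨d, rfl⟩ := M.exists_face_eq p
  refine Set.eq_univ_of_forall fun q => ?_
  obtain ⟨e, rfl⟩ := M.exists_face_eq q
  have key : ∀ v w : V, M.graph.Reachable v w →
      (∀ x : M.graph.Dart, x.fst = v → M.face x ∈ A) →
        (∀ x : M.graph.Dart, x.fst = w → M.face x ∈ A) := by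
    rintro v w ⟨p⟩
    induction p with
    | nil => exact id
    | cons hadj p ih =>
      rename_i a b c
      intro hx
      refine ih fun x hxb => ?_
      exact hv (SimpleGraph.Dart.mk (a, b) hadj).symm x hxb.symm (hcl _ (hx _ rfl))
  exact key d.fst e.fst (hconn.preconnected _ _) (fun x hx => hv d x hx.symm hp) e rfl

end RotationSystem

namespace PlaneTriangulation

open RotationSystem

variable {V : Type u} [Finite V] (T : PlaneTriangulation V)

lemma three_le_ncard_bd {A : Set T.Face} (hA : A.Nonempty) (hA' : A ≠ Set.univ) :
    3 ≤ (T.bd A).ncard := by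
  refine three_le_ncard_bd_of_nonempty ?_
  by_contra h
  exact hA' (eq_univ_of_bd_eq_empty T.connected hA (Set.not_nonempty_iff_eq_empty.1 h))

end PlaneTriangulation

namespace RotationSystem
variable {V : Type u} {M : RotationSystem V}

/-- All faces of the rotation system have length three. -/
def Triangular (M : RotationSystem V) : Prop :=
  ∀ d : M.graph.Dart, M.faceNext (M.faceNext (M.faceNext d)) = d

lemma Triangular.face_eq_iff (hM : M.Triangular) {d e : M.graph.Dart} :
    M.face e = M.face d ↔ e = d ∨ e = M.faceNext d ∨ e = M.faceNext (M.faceNext d) := by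
  constructor
  · intro h
    have h' := (M.face_eq_iff d e).1 h.symm
    have key : ∀ n : ℕ, (M.faceNext ^ n) d = d ∨ (M.faceNext ^ n) d = M.faceNext d ∨
        (M.faceNext ^ n) d = M.faceNext (M.faceNext d) := by
      intro n
      induction n with
      | zero => exact Or.inl rfl
      | succ n ih =>
        rw [pow_succ', Equiv.Perm.mul_apply]
        rcases ih with h | h | h <;> rw [h]
        · exact Or.inr (Or.inl rfl)
        · exact Or.inr (Or.inr rfl)
        · exact Or.inl (hM d)
    obtain ⟨i, hi⟩ := h'
    -- reduce an integral power to a natural one, using that the cube is the identity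
    have hcube : M.faceNext ^ (3 : ℤ) = 1 := by
      ext1 x
      exact hM x
    have : (M.faceNext ^ i) d = (M.faceNext ^ (i % 3).toNat) d := by
      have h3 : ((i % 3).toNat : ℤ) = i % 3 := Int.toNat_of_nonneg (Int.emod_nonneg _ (by norm_num))
      rw [← zpow_natCast, h3]
      conv_lhs => rw [← Int.mul_ediv_add_emod i 3, zpow_add, zpow_mul, hcube, one_zpow, one_mul]
    rw [← hi, this]
    exact key _
  · rintro (rfl | rfl | rfl) <;> simp

lemma Triangular.snd_faceNext_faceNext (hM : M.Triangular) (d : M.graph.Dart) :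
    (M.faceNext (M.faceNext d)).snd = d.fst := by
  rw [← M.faceNext_fst, hM]

lemma Triangular.setOf_face_eq (hM : M.Triangular) (d : M.graph.Dart) :
    {e | M.face e = M.face d} = {d, M.faceNext d, M.faceNext (M.faceNext d)} := by
  ext e
  simpa using hM.face_eq_iff

lemma faceNext_ne (d : M.graph.Dart) : M.faceNext d ≠ d := by
  intro h
  have := M.faceNext_fst d
  rw [h] at this
  exact d.fst_ne_snd this

lemma Triangular.faceNext_faceNext_ne (hM : M.Triangular) (d : M.graph.Dart) :
    M.faceNext (M.faceNext d) ≠ d := by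
  intro h
  have := hM d
  rw [h] at this
  exact faceNext_ne d this

lemma Triangular.ncard_face (hM : M.Triangular) (p : M.Face) :
    {e | M.face e = p}.ncard = 3 := by
  obtain ⟨d, rfl⟩ := M.exists_face_eq p
  rw [hM.setOf_face_eq]
  exact Set.ncard_eq_three.2 ⟨_, _, _, (faceNext_ne d).symm, (hM.faceNext_faceNext_ne d).symm,
    (faceNext_ne _).symm, rfl⟩

lemma Triangular.face_symm_ne (hM : M.Triangular) (d : M.graph.Dart) :
    M.face d.symm ≠ M.face d := by
  intro h
  rcases hM.face_eq_iff.1 h with h | h | h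
  · exact d.symm_ne h
  · have := congrArg (fun x : M.graph.Dart => x.snd) h
    have h2 : (M.faceNext (M.faceNext d)).fst = d.fst := by
      rw [M.faceNext_fst, ← h]; rfl
    exact (M.faceNext (M.faceNext d)).fst_ne_snd (h2.trans (hM.snd_faceNext_faceNext d).symm)
  · have h1 := congrArg (fun x : M.graph.Dart => x.fst) h
    have h2 : (M.faceNext d).fst = (M.faceNext d).snd := by
      rw [M.faceNext_fst, ← M.faceNext_fst (M.faceNext d)]; exact h1
    exact (M.faceNext d).fst_ne_snd h2

lemma Triangular.bd_singleton (hM : M.Triangular) (p : M.Face) :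
    M.bd {p} = {e | M.face e = p} := by
  ext d
  constructor
  · exact fun h => h.1
  · rintro rfl
    exact ⟨rfl, hM.face_symm_ne d⟩

lemma Triangular.ncard_bd_singleton (hM : M.Triangular) (p : M.Face) : (M.bd {p}).ncard = 3 := by
  rw [hM.bd_singleton, hM.ncard_face]

/-- Counting darts by faces. -/
lemma Triangular.ncard_face_mem [Finite V] (hM : M.Triangular) (A : Set M.Face) :
    {e | M.face e ∈ A}.ncard = 3 * A.ncard := by
  induction A, Set.toFinite A using Set.Finite.induction_on with
  | empty => simp
  | @insert a s ha hs ih =>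
    have : {e | M.face e ∈ insert a s} = {e | M.face e = a} ∪ {e | M.face e ∈ s} := by
      ext; simp
    rw [this, Set.ncard_union_eq, ih, hM.ncard_face, Set.ncard_insert_of_notMem ha]
    · ring
    · rw [Set.disjoint_left]
      rintro x rfl hx
      exact ha hx

end RotationSystem

/-! ### Euler's formula and cohomology modulo 2 -/

namespace RotationSystem

variable {V : Type u} (M : RotationSystem V)

/-- The undirected edge of a dart. -/
def edgeOf (d : M.graph.Dart) : M.graph.edgeSet := ⟨d.edge, d.edge_mem⟩

variable {M}

@[simp] lemma edgeOf_symm (d : M.graph.Dart) : M.edgeOf d.symm = M.edgeOf d :=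
  Subtype.ext d.edge_symm

lemma exists_edgeOf_eq (e : M.graph.edgeSet) : ∃ d, M.edgeOf d = e := by
  obtain ⟨e, he⟩ := e
  induction e using Sym2.ind with
  | _ a b => exact ⟨⟨(a, b), he⟩, rfl⟩

lemma edgeOf_eq_iff {d e : M.graph.Dart} : M.edgeOf d = M.edgeOf e ↔ d = e ∨ d = e.symm := by
  rw [← SimpleGraph.dart_edge_eq_iff]
  exact Subtype.ext_iff

variable (M) in
/-- The coboundary of a function on the vertices, modulo 2. -/
noncomputable def coboundary : (V → ZMod 2) →ₗ[ZMod 2] (M.graph.edgeSet → ZMod 2) where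
  toFun y e := y (Classical.choose (exists_edgeOf_eq e)).fst +
    y (Classical.choose (exists_edgeOf_eq e)).snd
  map_add' y z := by
    ext e
    simp only [Pi.add_apply]
    ring
  map_smul' a y := by
    ext e
    simp only [Pi.smul_apply, smul_eq_mul, RingHom.id_apply]
    ring

lemma coboundary_edgeOf (y : V → ZMod 2) (d : M.graph.Dart) :
    M.coboundary y (M.edgeOf d) = y d.fst + y d.snd := by
  have h := Classical.choose_spec (exists_edgeOf_eq (M.edgeOf d))
  change y (Classical.choose (exists_edgeOf_eq (M.edgeOf d))).fst + y _ = _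
  rcases edgeOf_eq_iff.1 h with h | h <;> rw [h]
  exact add_comm _ _

open Classical in
/-- The sum over the boundary of each face of a function on the edges, modulo 2. -/
noncomputable def faceSum [Fintype M.graph.Dart] :
    (M.graph.edgeSet → ZMod 2) →ₗ[ZMod 2] (M.Face → ZMod 2) where
  toFun x p := ∑ d : M.graph.Dart, if M.face d = p then x (M.edgeOf d) else 0
  map_add' y z := by
    ext e
    simp only [Pi.add_apply, ← Finset.sum_add_distrib]
    exact Finset.sum_congr rfl fun d _ => by split_ifs <;> simp
  map_smul' a y := by
    ext e
    simp only [Pi.smul_apply, smul_eq_mul, RingHom.id_apply, Finset.mul_sum]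
    exact Finset.sum_congr rfl fun d _ => by split_ifs <;> simp

lemma Triangular.faceSum_apply [Fintype M.graph.Dart] (hM : M.Triangular)
    (x : M.graph.edgeSet → ZMod 2) (d : M.graph.Dart) :
    faceSum x (M.face d) = x (M.edgeOf d) + x (M.edgeOf (M.faceNext d)) +
      x (M.edgeOf (M.faceNext (M.faceNext d))) := by
  classical
  change ∑ e : M.graph.Dart, (if M.face e = M.face d then x (M.edgeOf e) else 0) = _
  rw [← Finset.sum_filter]
  have : (Finset.univ.filter fun e => M.face e = M.face d) =
      {d, M.faceNext d, M.faceNext (M.faceNext d)} := by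
    ext e
    simpa using hM.face_eq_iff
  rw [this, Finset.sum_insert, Finset.sum_pair (faceNext_ne _).symm, add_assoc]
  simp only [Finset.mem_insert, Finset.mem_singleton, not_or]
  exact ⟨(faceNext_ne d).symm, (hM.faceNext_faceNext_ne d).symm⟩

/-- The image of `faceSum` consists of the functions with vanishing total sum: every edge is
counted twice, and the dual graph is connected. -/
lemma range_faceSum [Finite V] [Fintype M.graph.Dart] [Fintype M.Face]
    (hconn : M.graph.Connected) :
    LinearMap.range (faceSum (M := M)) =
      LinearMap.ker (∑ p : M.Face, LinearMap.proj (R := ZMod 2) (φ := fun _ => ZMod 2) p) := by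
  classical
  apply le_antisymm
  · rintro _ ⟨x, rfl⟩
    rw [LinearMap.mem_ker]
    simp only [LinearMap.coe_sum, Finset.sum_apply, LinearMap.coe_proj, Function.eval]
    change ∑ p : M.Face, ∑ d : M.graph.Dart, (if M.face d = p then x (M.edgeOf d) else 0) = 0
    rw [Finset.sum_comm]
    simp only [Finset.sum_ite_eq, Finset.mem_univ, if_true]
    refine Finset.sum_involution (fun d _ => d.symm) ?_ ?_ ?_ ?_
    · intro d _
      rw [edgeOf_symm]
      exact CharTwo.add_self_eq_zero _
    · intro d _ _
      exact d.symm_ne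
    · intro d _
      exact Finset.mem_univ _
    · intro d _
      exact d.symm_symm
  · intro y hy
    rw [LinearMap.mem_ker] at hy
    simp only [LinearMap.coe_sum, Finset.sum_apply, LinearMap.coe_proj, Function.eval] at hy
    by_cases hF : IsEmpty M.Face
    · rw [show y = 0 from Subsingleton.elim _ _]
      exact Submodule.zero_mem _
    rw [not_isEmpty_iff] at hF
    obtain ⟨p₀⟩ := hF
    have h2 : ∀ z : M.Face → ZMod 2, z + z = 0 := fun z => by
      ext q
      exact CharTwo.add_self_eq_zero _
    -- crossing edges shows that all `e_p + e_{p₀}` lie in the image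
    have key : ∀ p : M.Face, (Pi.single p 1 + Pi.single p₀ 1 : M.Face → ZMod 2) ∈
        LinearMap.range (faceSum (M := M)) := by
      let A : Set M.Face := {p | (Pi.single p 1 + Pi.single p₀ 1 : M.Face → ZMod 2) ∈
        LinearMap.range (faceSum (M := M))}
      suffices h : A = Set.univ from fun p => (h ▸ Set.mem_univ p : p ∈ A)
      refine eq_univ_of_bd_eq_empty hconn ⟨p₀, ?_⟩ ?_
      · change _ ∈ LinearMap.range _
        rw [h2]
        exact Submodule.zero_mem _
      · rw [Set.eq_empty_iff_forall_notMem]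
        rintro d ⟨h₁, h₂⟩
        refine h₂ ?_
        have h₃ : (Pi.single (M.face d) 1 + Pi.single (M.face d.symm) 1 : M.Face → ZMod 2) ∈
            LinearMap.range (faceSum (M := M)) := by
          refine ⟨Pi.single (M.edgeOf d) 1, ?_⟩
          ext p
          change ∑ e : M.graph.Dart, (if M.face e = p then
            (Pi.single (M.edgeOf d) (1 : ZMod 2) : M.graph.edgeSet → ZMod 2) (M.edgeOf e)
              else 0) = _
          rw [← Finset.sum_subset (Finset.subset_univ {d, d.symm}),
            Finset.sum_pair d.symm_ne.symm]
          · simp only [edgeOf_symm, Pi.single_eq_same, Pi.add_apply, Pi.single_apply]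
            simp only [eq_comm]
          · intro e _ he
            simp only [Finset.mem_insert, Finset.mem_singleton] at he
            rw [← edgeOf_eq_iff] at he
            rw [Pi.single_eq_of_ne he, ite_self]
        have := Submodule.add_mem _ h₃ h₁
        change _ ∈ LinearMap.range _
        convert this using 1
        linear_combination -h2 (Pi.single (M.face d) 1)
    have hy' : y = ∑ p : M.Face, y p • (Pi.single p 1 + Pi.single p₀ 1 : M.Face → ZMod 2) := by
      simp only [smul_add, Finset.sum_add_distrib, ← Finset.sum_smul, hy, zero_smul, add_zero]
      exact pi_eq_sum_univ' y
    rw [hy']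
    exact Submodule.sum_mem _ fun p _ => Submodule.smul_mem _ _ (key p)

/-- Euler's formula is equivalent to the vanishing of the first cohomology modulo 2 of a connected
map: its left side minus its right side is the difference of the dimensions of the
coboundaries and of the cocycles. -/
lemma Triangular.euler_iff [Finite V] (hM : M.Triangular) (hconn : M.graph.Connected)
    (hne : Nonempty M.Face) :
    Nat.card V + Nat.card M.Face = Nat.card M.graph.edgeSet + 2 ↔
      ∀ x : M.graph.edgeSet → ZMod 2,
        (∀ d, x (M.edgeOf d) + x (M.edgeOf (M.faceNext d)) +
          x (M.edgeOf (M.faceNext (M.faceNext d))) = 0) →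
        ∃ y : V → ZMod 2, ∀ d : M.graph.Dart, x (M.edgeOf d) = y d.fst + y d.snd := by
  classical
  have := Fintype.ofFinite V
  have := Fintype.ofFinite M.graph.Dart
  have := Fintype.ofFinite M.Face
  have := Fintype.ofFinite M.graph.edgeSet
  have hcond : (∀ x : M.graph.edgeSet → ZMod 2,
        (∀ d, x (M.edgeOf d) + x (M.edgeOf (M.faceNext d)) +
          x (M.edgeOf (M.faceNext (M.faceNext d))) = 0) →
        ∃ y : V → ZMod 2, ∀ d : M.graph.Dart, x (M.edgeOf d) = y d.fst + y d.snd) ↔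
      LinearMap.ker (faceSum (M := M)) ≤ LinearMap.range M.coboundary := by
    refine forall_congr' fun x => imp_congr ?_ ?_
    · rw [LinearMap.mem_ker]
      constructor
      · intro h
        ext p
        obtain ⟨d, rfl⟩ := M.exists_face_eq p
        rw [hM.faceSum_apply]
        exact h d
      · intro h d
        rw [← hM.faceSum_apply, h]
        rfl
    · rw [LinearMap.mem_range]
      refine exists_congr fun y => ⟨fun h => ?_, fun h d => ?_⟩
      · ext e
        obtain ⟨d, rfl⟩ := exists_edgeOf_eq e
        rw [coboundary_edgeOf, h]
      · rw [← h, coboundary_edgeOf]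
  have hle : LinearMap.range M.coboundary ≤ LinearMap.ker (faceSum (M := M)) := by
    rintro _ ⟨y, rfl⟩
    rw [LinearMap.mem_ker]
    ext p
    obtain ⟨d, rfl⟩ := M.exists_face_eq p
    rw [hM.faceSum_apply, coboundary_edgeOf, coboundary_edgeOf, coboundary_edgeOf,
      hM.snd_faceNext_faceNext, faceNext_fst, faceNext_fst, Pi.zero_apply]
    have h2 : ∀ a : ZMod 2, a + a = 0 := CharTwo.add_self_eq_zero
    linear_combination h2 (y d.fst) + h2 (y d.snd) + h2 (y (M.faceNext d).snd)
  -- the kernel of the coboundary consists of the constant functions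
  have hker : LinearMap.ker M.coboundary = Submodule.span (ZMod 2) {(1 : V → ZMod 2)} := by
    ext y
    rw [LinearMap.mem_ker, Submodule.mem_span_singleton]
    constructor
    · intro h
      have hadj : ∀ v w, M.graph.Adj v w → y v = y w := by
        intro v w hvw
        have := congrFun h (M.edgeOf ⟨(v, w), hvw⟩)
        rw [coboundary_edgeOf] at this
        exact CharTwo.add_eq_zero.1 this
      obtain ⟨v₀⟩ := hconn.nonempty
      refine ⟨y v₀, ?_⟩
      ext v
      obtain ⟨p⟩ := hconn.preconnected v₀ v
      have : y v₀ = y v := by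
        induction p with
        | nil => rfl
        | cons hadj' p ih => exact (hadj _ _ hadj').trans ih
      simpa using this
    · rintro ⟨a, rfl⟩
      ext e
      obtain ⟨d, rfl⟩ := exists_edgeOf_eq e
      rw [coboundary_edgeOf]
      exact CharTwo.add_self_eq_zero _
  have hnV := hconn.nonempty
  have h₁ : Module.finrank (ZMod 2) (LinearMap.ker M.coboundary) = 1 := by
    rw [hker]
    refine finrank_span_singleton fun h => ?_
    exact one_ne_zero (congrFun h hnV.some)
  have h₂ := LinearMap.finrank_range_add_finrank_ker M.coboundary
  have h₃ := LinearMap.finrank_range_add_finrank_ker (faceSum (M := M))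
  have h₄ : Module.finrank (ZMod 2) (LinearMap.range (faceSum (M := M))) + 1 =
      Fintype.card M.Face := by
    rw [range_faceSum hconn]
    set φ : (M.Face → ZMod 2) →ₗ[ZMod 2] ZMod 2 :=
      ∑ p : M.Face, LinearMap.proj (R := ZMod 2) (φ := fun _ => ZMod 2) p with hφ
    have h₅ := LinearMap.finrank_range_add_finrank_ker φ
    have hs : LinearMap.range φ = ⊤ := by
      rw [LinearMap.range_eq_top]
      intro a
      refine ⟨Pi.single hne.some a, ?_⟩
      simp [hφ]
    rw [hs, finrank_top, Module.finrank_self, Module.finrank_fintype_fun_eq_card] at h₅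
    omega
  rw [h₁, Module.finrank_fintype_fun_eq_card] at h₂
  rw [Module.finrank_fintype_fun_eq_card] at h₃
  rw [hcond, Nat.card_eq_fintype_card, Nat.card_eq_fintype_card, Nat.card_eq_fintype_card]
  constructor
  · intro h
    exact (Submodule.eq_of_le_of_finrank_eq hle (by omega)).ge
  · intro h
    have := congrArg (fun s : Submodule (ZMod 2) (M.graph.edgeSet → ZMod 2) =>
      Module.finrank (ZMod 2) s) (le_antisymm h hle)
    change Module.finrank (ZMod 2) _ = Module.finrank (ZMod 2) _ at this
    omega

/-- A version of `Triangular.euler_iff` for symmetric functions on the darts. -/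
lemma Triangular.euler_iff_dart [Finite V] (hM : M.Triangular) (hconn : M.graph.Connected)
    (hne : Nonempty M.Face) :
    Nat.card V + Nat.card M.Face = Nat.card M.graph.edgeSet + 2 ↔
      ∀ x : M.graph.Dart → ZMod 2, (∀ d, x d.symm = x d) →
        (∀ d, x d + x (M.faceNext d) + x (M.faceNext (M.faceNext d)) = 0) →
        ∃ y : V → ZMod 2, ∀ d : M.graph.Dart, x d = y d.fst + y d.snd := by
  rw [hM.euler_iff hconn hne]
  constructor
  · intro h x hx hx'
    have hval : ∀ d, x (Classical.choose (exists_edgeOf_eq (M.edgeOf d))) = x d := by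
      intro d
      rcases edgeOf_eq_iff.1 (Classical.choose_spec (exists_edgeOf_eq (M.edgeOf d))) with h | h
      · rw [h]
      · rw [h, hx]
    obtain ⟨y, hy⟩ := h (fun e => x (Classical.choose (exists_edgeOf_eq e)))
      (fun d => by simp only [hval]; exact hx' d)
    exact ⟨y, fun d => by rw [← hy, hval]⟩
  · intro h x hx
    exact h (fun d => x (M.edgeOf d)) (fun d => by simp) hx

end RotationSystem

namespace PlaneTriangulation

open RotationSystem

variable {V : Type u} [Finite V] (T : PlaneTriangulation V)

lemma isTriangular : T.toRotationSystem.Triangular := T.triangular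

variable {T}

lemma isMonochromatic_iff {c : V → VertexColor} {p : T.Face} :
    T.IsMonochromatic c p ↔ ∀ d, T.face d = p → c d.fst = c d.snd := by
  constructor
  · rintro ⟨k, hk⟩ d rfl
    rw [hk d.fst ⟨d, rfl, rfl⟩, hk d.snd ⟨T.faceNext d, by simp, by simp⟩]
  · intro h
    obtain ⟨d, rfl⟩ := T.exists_face_eq p
    refine ⟨c d.fst, ?_⟩
    rintro v ⟨e, he, rfl⟩
    have h₁ := h d rfl
    have h₂ := h (T.faceNext d) (by simp)
    rw [faceNext_fst] at h₂
    rcases T.isTriangular.face_eq_iff.1 he with rfl | rfl | rfl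
    · rfl
    · simp [h₁]
    · simp [h₁, h₂]

/-- The two colors, as residues modulo 2. -/
noncomputable def colorOf (a : ZMod 2) : VertexColor :=
  if a = 0 then VertexColor.black else VertexColor.white

lemma colorOf_eq_iff (a b : ZMod 2) : colorOf a = colorOf b ↔ a + b = 0 := by
  have : ∀ a : ZMod 2, a = 0 ∨ a = 1 := by decide
  rcases this a with rfl | rfl <;> rcases this b with rfl | rfl <;> (simp [colorOf]; try decide)

/-- In the sphere, a set of edges is the set of monochromatic edges of a vertex coloring if every
face contains one or three of them. -/
lemma exists_coloring (μ : T.graph.Dart → Prop) (hsymm : ∀ d, μ d → μ d.symm)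
    (hμ : ∀ p : T.Face, (∃! d, T.face d = p ∧ μ d) ∨ ∀ d, T.face d = p → μ d) :
    ∃ c : V → VertexColor, ∀ d : T.graph.Dart, c d.fst = c d.snd ↔ μ d := by
  classical
  by_cases hne : Nonempty T.Face
  swap
  · exact ⟨fun _ => VertexColor.black, fun d => (hne ⟨T.face d⟩).elim⟩
  have hsymm' : ∀ d, μ d.symm ↔ μ d := fun d =>
    ⟨fun h => by simpa using hsymm _ h, hsymm d⟩
  obtain ⟨y, hy⟩ := (T.isTriangular.euler_iff_dart T.connected hne).1 T.euler
    (fun d => if μ d then 0 else 1) (fun d => by simp only [hsymm'])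
    (fun d => by
      rcases hμ (T.face d) with ⟨e, ⟨he, hμe⟩, huniq⟩ | h
      · have hd : ∀ x, T.face x = T.face d → (μ x ↔ x = e) :=
          fun x hx => ⟨fun h => huniq x ⟨hx, h⟩, fun h => h ▸ hμe⟩
        have h₁ := (faceNext_ne (M := T.toRotationSystem) d)
        have h₂ := T.isTriangular.faceNext_faceNext_ne d
        have h₃ := (faceNext_ne (M := T.toRotationSystem) (T.faceNext d))
        rw [if_congr (hd d rfl) rfl rfl, if_congr (hd (T.faceNext d) (by simp)) rfl rfl,
          if_congr (hd (T.faceNext (T.faceNext d)) (by simp)) rfl rfl]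
        rcases T.isTriangular.face_eq_iff.1 he with rfl | rfl | rfl
        · rw [if_pos rfl, if_neg h₁, if_neg h₂]; decide
        · rw [if_pos rfl, if_neg h₁.symm, if_neg h₃]; decide
        · rw [if_pos rfl, if_neg h₂.symm, if_neg h₃.symm]; decide
      · simp [h d rfl, h (T.faceNext d), h (T.faceNext (T.faceNext d))])
  refine ⟨fun v => colorOf (y v), fun d => ?_⟩
  rw [colorOf_eq_iff, ← hy]
  split_ifs with h <;> simp [h]

end PlaneTriangulation

/-! ### Counting in properly face-colored triangulations -/

open RotationSystem

lemma FaceColor.eq_blue_iff {k : FaceColor} : k = FaceColor.blue ↔ k ≠ FaceColor.red := by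
  cases k <;> simp

namespace PlaneTriangulation

variable {V : Type u} [Finite V] {T : PlaneTriangulation V}

/-- Darts along red faces of `A` that are not on the boundary of `A` correspond, by reversal, to
such darts along blue faces. -/
lemma IsProperFaceColoring.ncard_inner_eq {ψ : T.Face → FaceColor} (hψ : T.IsProperFaceColoring ψ)
    (A : Set T.Face) (s : Set T.graph.Dart) (hs : ∀ d ∈ s, d.symm ∈ s) :
    {d ∈ s | T.face d ∈ A ∧ T.face d.symm ∈ A ∧ ψ (T.face d) = FaceColor.red}.ncard =
      {d ∈ s | T.face d ∈ A ∧ T.face d.symm ∈ A ∧ ψ (T.face d) = FaceColor.blue}.ncard := by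
  rw [← Set.ncard_image_of_injective _
    (SimpleGraph.Dart.symm_involutive (G := T.graph)).injective]
  congr 1
  ext d
  constructor
  · rintro ⟨e, ⟨h₀, h₁, h₂, h₃⟩, rfl⟩
    refine ⟨hs _ h₀, h₂, by simpa using h₁, ?_⟩
    rw [FaceColor.eq_blue_iff, ← h₃]
    exact (hψ e).symm
  · rintro ⟨h₀, h₁, h₂, h₃⟩
    refine ⟨d.symm, ⟨hs _ h₀, h₂, by simpa using h₁, ?_⟩, d.symm_symm⟩
    by_contra h
    rw [← ne_eq, ← FaceColor.eq_blue_iff, ← h₃] at h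
    exact hψ d h.symm

lemma ncard_color_eq (ψ : T.Face → FaceColor) (A : Set T.Face) (s : Set T.graph.Dart)
    (k : FaceColor) :
    {d ∈ s | T.face d ∈ A ∧ ψ (T.face d) = k}.ncard =
      {d ∈ s | T.face d ∈ A ∧ T.face d.symm ∈ A ∧ ψ (T.face d) = k}.ncard +
        {d ∈ s | d ∈ T.bd A ∧ ψ (T.face d) = k}.ncard := by
  rw [← Set.ncard_union_eq]
  · congr 1
    ext d
    simp only [Set.mem_ofPred_eq, Set.mem_union, mem_bd]
    tauto
  · rw [Set.disjoint_left]
    rintro d ⟨-, -, h, -⟩ ⟨-, h', -⟩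
    exact h'.2 h

lemma ncard_face_color (ψ : T.Face → FaceColor) (A : Set T.Face) (k : FaceColor) :
    {d ∈ (Set.univ : Set T.graph.Dart) | T.face d ∈ A ∧ ψ (T.face d) = k}.ncard =
      3 * {p ∈ A | ψ p = k}.ncard := by
  rw [← T.isTriangular.ncard_face_mem]
  congr 1
  ext d
  simp

/-- In a properly face-colored triangulation, the faces along the inner side of a boundary of
length three all have the same color: the numbers of red and of blue ones are congruent
modulo 3. -/
lemma IsProperFaceColoring.exists_bd_color {ψ : T.Face → FaceColor}
    (hψ : T.IsProperFaceColoring ψ) {A : Set T.Face} (hA : (T.bd A).ncard = 3) :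
    ∃ k, ∀ d ∈ T.bd A, ψ (T.face d) = k := by
  have h₁ := hψ.ncard_inner_eq A Set.univ (fun _ _ => Set.mem_univ _)
  have h₂ := ncard_color_eq ψ A Set.univ FaceColor.red
  have h₃ := ncard_color_eq ψ A Set.univ FaceColor.blue
  rw [ncard_face_color] at h₂ h₃
  have h₄ : {d ∈ (Set.univ : Set T.graph.Dart) | d ∈ T.bd A ∧ ψ (T.face d) = FaceColor.red}.ncard +
      {d ∈ (Set.univ : Set T.graph.Dart) | d ∈ T.bd A ∧ ψ (T.face d) = FaceColor.blue}.ncard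
        = 3 := by
    rw [← hA, ← Set.ncard_union_eq]
    · congr 1
      ext d
      cases h : ψ (T.face d) <;> simp [h]
    · rw [Set.disjoint_left]
      rintro d ⟨-, -, h⟩ ⟨-, -, h'⟩
      rw [h] at h'
      cases h'
  by_contra! hcon
  obtain ⟨d, hd, hd'⟩ := hcon FaceColor.red
  obtain ⟨e, he, he'⟩ := hcon FaceColor.blue
  have h₅ : {d ∈ (Set.univ : Set T.graph.Dart) | d ∈ T.bd A ∧
      ψ (T.face d) = FaceColor.blue}.ncard ≠ 0 :=
    Set.ncard_ne_zero_of_mem (a := d) ⟨Set.mem_univ _, hd, FaceColor.eq_blue_iff.2 hd'⟩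
      (Set.toFinite _)
  have h₆ : {d ∈ (Set.univ : Set T.graph.Dart) | d ∈ T.bd A ∧
      ψ (T.face d) = FaceColor.red}.ncard ≠ 0 := by
    refine Set.ncard_ne_zero_of_mem (a := e) ⟨Set.mem_univ _, he, ?_⟩ (Set.toFinite _)
    by_contra h
    exact he' (FaceColor.eq_blue_iff.2 h)
  omega

lemma exists_monochromatic_dart (c : V → VertexColor) (p : T.Face) :
    ∃ d, T.face d = p ∧ c d.fst = c d.snd := by
  obtain ⟨d, rfl⟩ := T.exists_face_eq p
  have h₁ := T.isTriangular.snd_faceNext_faceNext d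
  have : c d.fst = c d.snd ∨ c d.snd = c (T.faceNext d).snd ∨ c (T.faceNext d).snd = c d.fst := by
    cases c d.fst <;> cases c d.snd <;> cases c (T.faceNext d).snd <;> simp
  rcases this with h | h | h
  · exact ⟨d, rfl, h⟩
  · exact ⟨T.faceNext d, by simp, by simpa using h⟩
  · exact ⟨T.faceNext (T.faceNext d), by simp, by rw [h₁, faceNext_fst]; exact h⟩

lemma eq_of_monochromatic_dart {c : V → VertexColor} {d e : T.graph.Dart}
    (hmono : ¬ T.IsMonochromatic c (T.face d)) (h : T.face e = T.face d)
    (hd : c d.fst = c d.snd) (he : c e.fst = c e.snd) : e = d := by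
  by_contra hne
  refine hmono (isMonochromatic_iff.2 ?_)
  have h₁ := T.isTriangular.snd_faceNext_faceNext d
  have h₂ : c d.snd = c (T.faceNext d).snd := by
    rcases T.isTriangular.face_eq_iff.1 h with rfl | rfl | rfl
    · exact absurd rfl hne
    · simpa using he
    · rw [h₁, faceNext_fst] at he
      rw [he, hd]
  intro x hx
  rcases T.isTriangular.face_eq_iff.1 hx with rfl | rfl | rfl
  · exact hd
  · simpa using h₂
  · rw [h₁, faceNext_fst, ← h₂, hd]

/-- Counting monochromatic edges: if a triangle is monochromatic and the faces along its inner
side are blue, then some blue face inside is monochromatic.  Otherwise each blue face has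
one monochromatic edge, each red face at least one, and there is one blue face more than red
ones, whereas three of the monochromatic edges are on no red face. -/
lemma IsProperFaceColoring.exists_blue_monochromatic {ψ : T.Face → FaceColor}
    (hψ : T.IsProperFaceColoring ψ) {A : Set T.Face} (hA : (T.bd A).ncard = 3)
    (hblue : ∀ d ∈ T.bd A, ψ (T.face d) = FaceColor.blue) {c : V → VertexColor}
    (hc : ∀ d ∈ T.bd A, c d.fst = c d.snd) :
    ∃ p ∈ A, ψ p = FaceColor.blue ∧ T.IsMonochromatic c p := by
  by_contra! hcon
  let m : Set T.graph.Dart := {d | c d.fst = c d.snd}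
  have hm : ∀ d ∈ m, d.symm ∈ m := fun d hd => Eq.symm hd
  have hred : ∀ s : Set T.graph.Dart,
      {d ∈ s | d ∈ T.bd A ∧ ψ (T.face d) = FaceColor.red}.ncard = 0 := by
    intro s
    rw [Set.ncard_eq_zero (Set.toFinite _), Set.eq_empty_iff_forall_notMem]
    rintro d ⟨-, hd, hd'⟩
    rw [hblue d hd] at hd'
    cases hd'
  have hblue' : ∀ s : Set T.graph.Dart, T.bd A ⊆ s →
      {d ∈ s | d ∈ T.bd A ∧ ψ (T.face d) = FaceColor.blue}.ncard = 3 := by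
    intro s hs
    rw [← hA]
    congr 1
    ext d
    exact ⟨fun h => h.2.1, fun h => ⟨hs h, h, hblue d h⟩⟩
  have h₁ := hψ.ncard_inner_eq A Set.univ (fun _ _ => Set.mem_univ _)
  have h₂ := ncard_color_eq ψ A Set.univ FaceColor.red
  have h₃ := ncard_color_eq ψ A Set.univ FaceColor.blue
  rw [ncard_face_color, hred] at h₂
  rw [ncard_face_color, hblue' _ (Set.subset_univ _)] at h₃
  have h₁' := hψ.ncard_inner_eq A m hm
  have h₂' := ncard_color_eq ψ A m FaceColor.red
  have h₃' := ncard_color_eq ψ A m FaceColor.blue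
  rw [hred] at h₂'
  rw [hblue' m hc] at h₃'
  -- every red face has a monochromatic edge
  have h₄ : {p ∈ A | ψ p = FaceColor.red}.ncard ≤
      {d ∈ m | T.face d ∈ A ∧ ψ (T.face d) = FaceColor.red}.ncard := by
    refine (Set.ncard_le_ncard (t := T.face '' _) ?_ (Set.toFinite _)).trans
      (Set.ncard_image_le (Set.toFinite _))
    rintro p ⟨hp, hp'⟩
    obtain ⟨d, rfl, hd⟩ := exists_monochromatic_dart c p
    exact ⟨d, ⟨hd, hp, hp'⟩, rfl⟩
  -- every blue face has at most one monochromatic edge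
  have h₅ : {d ∈ m | T.face d ∈ A ∧ ψ (T.face d) = FaceColor.blue}.ncard ≤
      {p ∈ A | ψ p = FaceColor.blue}.ncard := by
    refine Set.ncard_le_ncard_of_injOn T.face ?_ ?_ (Set.toFinite _)
    · rintro d ⟨-, h⟩
      exact h
    · rintro d ⟨hd, hdA, hdb⟩ e ⟨he, -, -⟩ hde
      exact (eq_of_monochromatic_dart (hcon _ hdA hdb) hde.symm hd he).symm
  omega

lemma IsProperFaceColoring.eulerian {ψ : T.Face → FaceColor} (hψ : T.IsProperFaceColoring ψ) :
    T.Eulerian := by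
  intro v
  have h₁ : (T.graph.neighborSet v).ncard = {d : T.graph.Dart | d.fst = v}.ncard := by
    have : T.graph.neighborSet v = (fun d : T.graph.Dart => d.snd) '' {d | d.fst = v} := by
      ext w
      constructor
      · exact fun h => ⟨⟨(v, w), h⟩, rfl, rfl⟩
      · rintro ⟨d, rfl, rfl⟩
        exact d.adj
    rw [this, Set.InjOn.ncard_image]
    rintro d hd e he h
    exact T.dart_ext (Eq.trans hd (Eq.symm he)) h
  have h₂ : {d : T.graph.Dart | d.fst = v}.ncard =
      {d : T.graph.Dart | d.fst = v ∧ ψ (T.face d) = FaceColor.red}.ncard +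
      {d : T.graph.Dart | d.fst = v ∧ ψ (T.face d) = FaceColor.blue}.ncard := by
    rw [← Set.ncard_union_eq]
    · congr 1
      ext d
      cases h : ψ (T.face d) <;> simp [h]
    · rw [Set.disjoint_left]
      rintro d ⟨-, h⟩ ⟨-, h'⟩
      rw [h] at h'
      cases h'
  -- the rotation alternates between the colors
  have hrot : ∀ d, ψ (T.face (T.rot d)) ≠ ψ (T.face d) := by
    intro d
    rw [face_rot]
    exact (hψ d).symm
  have h₃ : T.rot '' {d : T.graph.Dart | d.fst = v ∧ ψ (T.face d) = FaceColor.red} =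
      {d : T.graph.Dart | d.fst = v ∧ ψ (T.face d) = FaceColor.blue} := by
    ext d
    constructor
    · rintro ⟨e, ⟨he, he'⟩, rfl⟩
      exact ⟨(T.rot_fst e).trans he, FaceColor.eq_blue_iff.2 (he' ▸ hrot e)⟩
    · rintro ⟨hd, hd'⟩
      obtain ⟨e, rfl⟩ := T.rot.surjective d
      refine ⟨e, ⟨(T.rot_fst e).symm.trans hd, ?_⟩, rfl⟩
      by_contra h
      exact hrot e (hd'.trans (FaceColor.eq_blue_iff.2 h).symm)
  rw [h₁, h₂, ← h₃, Set.ncard_image_of_injective _ T.rot.injective]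
  exact ⟨_, rfl⟩

lemma nontrivial_of_mem_faceVerts {A : Set T.Face} {a b c x : V} {p : T.Face} (hp : p ∈ A)
    (hA : ∀ d ∈ T.bd A, d.edge ∈ ({s(a, b), s(b, c), s(c, a)} : Set (Sym2 V)))
    (hx : x ∉ ({a, b, c} : Set V)) (hxp : x ∈ T.faceVerts p) : A.Nontrivial := by
  by_contra h
  rw [Set.not_nontrivial_iff] at h
  have hA' : A = {p} := h.eq_singleton_of_mem hp
  obtain ⟨d, hd, rfl⟩ := hxp
  have hmem : d ∈ T.bd A := by
    rw [hA', T.isTriangular.bd_singleton]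
    exact hd
  have := hA d hmem
  have hmem' : d.fst ∈ d.edge := Sym2.mem_mk_left _ _
  refine hx ?_
  rcases this with h | h | h <;> rw [h, Sym2.mem_iff] at hmem' <;>
    rcases hmem' with h' | h' <;> simp [h']

/-- A separating triangle has a side that avoids a given face; both sides consist of several
faces. -/
lemma IsSeparatingTriangle.exists_side {a b c : V} (h : T.IsSeparatingTriangle a b c)
    (r : T.Face) :
    ∃ A : Set T.Face, r ∉ A ∧ A.Nontrivial ∧ Aᶜ.Nontrivial ∧ (T.bd A).ncard = 3 := by
  obtain ⟨-, -, -, x, y, hx, hy, p, q, hxp, hyq, hpq⟩ := h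
  set C : Set (Sym2 V) := {s(a, b), s(b, c), s(c, a)} with hC
  have hsymm : ∀ p q, T.SameRegion C p q → T.SameRegion C q p :=
    fun p q h => Relation.EqvGen.symm _ _ h
  have htrans : ∀ p q r, T.SameRegion C p q → T.SameRegion C q r → T.SameRegion C p r :=
    fun p q r h h' => Relation.EqvGen.trans _ _ _ h h'
  have key : ∀ p q : T.Face, ∀ x y : V, x ∉ ({a, b, c} : Set V) → y ∉ ({a, b, c} : Set V) →
      x ∈ T.faceVerts p → y ∈ T.faceVerts q → ¬ T.SameRegion C p q → ¬ T.SameRegion C p r →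
      ∃ A : Set T.Face, r ∉ A ∧ A.Nontrivial ∧ Aᶜ.Nontrivial ∧ (T.bd A).ncard = 3 := by
    intro p q x y hx hy hxp hyq hpq hpr
    have hbd : ∀ d ∈ T.bd {z | T.SameRegion C p z}, d.edge ∈ C := by
      intro d hd
      by_contra hdC
      exact hd.2 (htrans _ _ _ hd.1 (Relation.EqvGen.rel _ _ ⟨d, hdC, rfl, rfl⟩))
    have hbd' : ∀ d ∈ T.bd {z | T.SameRegion C p z}ᶜ, d.edge ∈ C := by
      intro d hd
      rw [bd_compl] at hd
      obtain ⟨e, he, rfl⟩ := hd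
      rw [SimpleGraph.Dart.edge_symm]
      exact hbd e he
    have hp : p ∈ {z | T.SameRegion C p z} := Relation.EqvGen.refl _
    have hq : q ∈ {z | T.SameRegion C p z}ᶜ := hpq
    refine ⟨{z | T.SameRegion C p z}, hpr, nontrivial_of_mem_faceVerts hp hbd hx hxp,
      nontrivial_of_mem_faceVerts hq hbd' hy hyq, le_antisymm ?_ ?_⟩
    · have h₁ : (T.bd {z | T.SameRegion C p z}).ncard ≤ C.ncard := by
        refine Set.ncard_le_ncard_of_injOn (fun d => d.edge) hbd ?_ (Set.toFinite _)
        intro d hd e he hde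
        rcases (SimpleGraph.dart_edge_eq_iff d e).1 hde with h | h
        · exact h
        · exact absurd hd.1 (h ▸ he.2)
      refine h₁.trans ?_
      rw [hC]
      exact (Set.ncard_insert_le _ _).trans (Nat.succ_le_succ
        ((Set.ncard_insert_le _ _).trans (by simp)))
    · exact T.three_le_ncard_bd ⟨p, hp⟩ fun h => hq (h ▸ Set.mem_univ q)
  by_cases hpr : T.SameRegion C p r
  · exact key q p y x hy hx hyq hxp (fun h => hpq (hsymm _ _ h))
      fun h => hpq (htrans _ _ _ hpr (hsymm _ _ h))
  · exact key p q x y hx hy hxp hyq hpq hpr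

/-- A set of faces is tight if every vertex coloring that is constant on its boundary makes one of
its faces monochromatic. -/
def Tight (T : PlaneTriangulation V) (A : Set T.Face) : Prop :=
  ∀ c : V → VertexColor, (∃ k, ∀ d ∈ T.bd A, c d.fst = k) → ∃ p ∈ A, T.IsMonochromatic c p

lemma bd_compl_singleton_fst (f : T.Face) (v : V) :
    (∃ d ∈ T.bd {f}ᶜ, d.fst = v) ↔ v ∈ T.faceVerts f := by
  rw [bd_compl, T.isTriangular.bd_singleton]
  constructor
  · rintro ⟨_, ⟨d, hd, rfl⟩, rfl⟩
    exact ⟨T.faceNext d, by simpa using hd, T.faceNext_fst d⟩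
  · rintro ⟨d, hd, rfl⟩
    refine ⟨_, ⟨T.faceNext (T.faceNext d), by simpa using hd, rfl⟩, ?_⟩
    exact T.isTriangular.snd_faceNext_faceNext d

/-- The complement of `f` is tight if and only if every coloring in which `f` is monochromatic
has a second monochromatic face. -/
lemma tight_compl_singleton {f : T.Face} :
    T.Tight {f}ᶜ ↔ ∀ c, T.IsMonochromatic c f → ∃ p, p ≠ f ∧ T.IsMonochromatic c p := by
  refine forall_congr' fun c => imp_congr (exists_congr fun k => ?_) Iff.rfl
  constructor
  · intro h v hv
    obtain ⟨d, hd, rfl⟩ := (bd_compl_singleton_fst f v).2 hv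
    exact h d hd
  · intro h d hd
    exact h _ ((bd_compl_singleton_fst f _).1 ⟨d, hd, rfl⟩)

end PlaneTriangulation

lemma Pasting.isMonochromatic_inl {V W : Type u} [Finite V] [Finite W]
    {T : PlaneTriangulation V} {E : PlaneTriangulation W} (P : Pasting T E) (c : V → VertexColor)
    (p : {p : E.Face // p ∉ P.pasted}) :
    T.IsMonochromatic c (P.faceEquiv (Sum.inl p)) ↔ E.IsMonochromatic (c ∘ P.incl) p.1 := by
  simp [PlaneTriangulation.IsMonochromatic, P.faceVerts_inl]

lemma Pasting.isMonochromatic_inr {V W : Type u} [Finite V] [Finite W]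
    {T : PlaneTriangulation V} {E : PlaneTriangulation W} (P : Pasting T E) (c : V → VertexColor)
    (g : P.pasted) (p : {p : (P.piece g).tri.Face // p ≠ (P.piece g).root}) :
    T.IsMonochromatic c (P.faceEquiv (Sum.inr ⟨g, p⟩)) ↔
      (P.piece g).tri.IsMonochromatic (c ∘ P.pieceIncl g) p.1 := by
  simp [PlaneTriangulation.IsMonochromatic, P.faceVerts_inr]

lemma Pasting.isMonochromatic_root {V W : Type u} [Finite V] [Finite W]
    {T : PlaneTriangulation V} {E : PlaneTriangulation W} (P : Pasting T E) (c : V → VertexColor)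
    (g : P.pasted) :
    (P.piece g).tri.IsMonochromatic (c ∘ P.pieceIncl g) (P.piece g).root ↔
      E.IsMonochromatic (c ∘ P.incl) g := by
  have h := P.glue g
  have h₁ : ∀ k, (∀ v ∈ P.pieceIncl g '' (P.piece g).tri.faceVerts (P.piece g).root, c v = k) ↔
      ∀ v ∈ P.incl '' E.faceVerts g, c v = k := by rw [h]; exact fun _ => Iff.rfl
  simpa [PlaneTriangulation.IsMonochromatic] using exists_congr h₁

/-- A coloring of a quasi-Eulerian triangulation in which the root face is monochromatic has
another monochromatic face. -/
lemma QuasiEulerianClass.tight {n : ℕ} : ∀ {T : RootedTriangulation.{u}},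
    QuasiEulerianClass n T → T.tri.Tight {T.root}ᶜ := by
  induction n with
  | zero => exact fun h => h.elim
  | succ n ih =>
    rintro T ⟨E, ψ, P, -, -, hψ, hred, ⟨hroot, hroot'⟩, hblue⟩
    rw [PlaneTriangulation.tight_compl_singleton]
    intro c hc
    rw [← hroot', P.isMonochromatic_inl] at hc
    have hbd : ∀ d ∈ E.tri.bd {E.root}ᶜ, (c ∘ P.incl) d.fst = (c ∘ P.incl) d.snd := by
      rw [bd_compl, E.tri.isTriangular.bd_singleton]
      rintro _ ⟨d, hd, rfl⟩
      exact (PlaneTriangulation.isMonochromatic_iff.1 hc d hd).symm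
    obtain ⟨g, hg, hgb, hgm⟩ := hψ.exists_blue_monochromatic (A := {E.root}ᶜ)
      (by rw [ncard_bd_compl, E.tri.isTriangular.ncard_bd_singleton])
      (by
        rw [bd_compl, E.tri.isTriangular.bd_singleton]
        rintro _ ⟨d, hd, rfl⟩
        have hd' : E.tri.face d = E.root := hd
        rw [FaceColor.eq_blue_iff, ← hred, ← hd']
        exact (hψ d).symm) hbd
    by_cases hgP : g ∈ P.pasted
    · have ht := PlaneTriangulation.tight_compl_singleton.1 (ih (hblue ⟨g, hgP⟩ hgb))
      obtain ⟨p, hp, hpm⟩ := ht (c ∘ P.pieceIncl ⟨g, hgP⟩)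
        ((P.isMonochromatic_root c ⟨g, hgP⟩).2 hgm)
      refine ⟨P.faceEquiv (Sum.inr ⟨⟨g, hgP⟩, ⟨p, hp⟩⟩), ?_, ?_⟩
      · rw [← hroot', Ne, P.faceEquiv.injective.eq_iff]
        exact Sum.inr_ne_inl
      · exact (P.isMonochromatic_inr c ⟨g, hgP⟩ ⟨p, hp⟩).2 hpm
    · refine ⟨P.faceEquiv (Sum.inl ⟨g, hgP⟩), ?_, ?_⟩
      · rw [← hroot', Ne, P.faceEquiv.injective.eq_iff]
        rintro h
        cases h
        exact hg rfl
      · exact (P.isMonochromatic_inl c ⟨g, hgP⟩).2 hgm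

/-! ### Contracting the parts of a partition of the faces -/

namespace PlaneTriangulation

variable {V : Type u} [Finite V] {T : PlaneTriangulation V} {Q : Type*}

/-- The darts that separate two different parts of the partition of the faces into the fibers
of `π`. -/
def crossing (π : T.Face → Q) : Set T.graph.Dart := {d | π (T.face d) ≠ π (T.face d.symm)}

lemma mem_bd_fiber {π : T.Face → Q} {q : Q} {d : T.graph.Dart} :
    d ∈ T.bd (π ⁻¹' {q}) ↔ d ∈ crossing π ∧ π (T.face d) = q := by
  constructor
  · rintro ⟨h, h'⟩
    exact ⟨fun h'' => h' (h''.symm.trans h), h⟩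
  · rintro ⟨h, rfl⟩
    exact ⟨rfl, fun h' => h (Eq.symm h')⟩

lemma symm_mem_crossing {π : T.Face → Q} {d : T.graph.Dart} (hd : d ∈ crossing π) :
    d.symm ∈ crossing π := by
  simpa [crossing] using Ne.symm hd

/-- The parts of the partition of the faces into the fibers of `π` are bounded by 3-cycles. -/
def TriangularParts (π : T.Face → Q) : Prop := ∀ p, (T.bd (π ⁻¹' {π p})).ncard = 3

section

variable {π : T.Face → Q}

/-- The crossing darts of a part form a directed 3-cycle. -/
lemma TriangularParts.triangle (hπ : TriangularParts π) {d : T.graph.Dart} (hd : d ∈ crossing π) :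
    ∃ e g : T.graph.Dart, e ∈ crossing π ∧ g ∈ crossing π ∧
      π (T.face e) = π (T.face d) ∧ π (T.face g) = π (T.face d) ∧
      (∀ x ∈ crossing π, π (T.face x) = π (T.face d) → x = d ∨ x = e ∨ x = g) ∧
      e.fst = d.snd ∧ g.fst = e.snd ∧ g.snd = d.fst ∧ e.snd ≠ d.fst := by
  obtain ⟨e, g, heq, h₁, h₂, h₃, h₄⟩ := bd_eq_triangle (hπ (T.face d))
    (mem_bd_fiber.2 ⟨hd, rfl⟩)
  have he : e ∈ T.bd (π ⁻¹' {π (T.face d)}) := heq ▸ by simp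
  have hg : g ∈ T.bd (π ⁻¹' {π (T.face d)}) := heq ▸ by simp
  refine ⟨e, g, (mem_bd_fiber.1 he).1, (mem_bd_fiber.1 hg).1, (mem_bd_fiber.1 he).2,
    (mem_bd_fiber.1 hg).2, fun x hx hx' => ?_, h₁, h₂, h₃, h₄⟩
  have : x ∈ T.bd (π ⁻¹' {π (T.face d)}) := mem_bd_fiber.2 ⟨hx, hx'⟩
  rw [heq] at this
  exact this

lemma TriangularParts.eq_of_fst_eq (hπ : TriangularParts π) {d e : T.graph.Dart}
    (hd : d ∈ crossing π) (he : e ∈ crossing π) (h : π (T.face d) = π (T.face e))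
    (hf : d.fst = e.fst) : d = e :=
  bd_fst_injOn (hπ (T.face e)) (mem_bd_fiber.2 ⟨hd, h⟩) (mem_bd_fiber.2 ⟨he, rfl⟩) hf

lemma TriangularParts.exists_next (hπ : TriangularParts π) (d : crossing π) :
    ∃ e : crossing π, π (T.face e.1) = π (T.face d.1) ∧ e.1.fst = d.1.snd := by
  obtain ⟨e, g, he, -, h, -, -, h', -⟩ := hπ.triangle d.2
  exact ⟨⟨e, he⟩, h, h'⟩

end

/-- The successor of a crossing dart along the boundary of its part. -/
noncomputable def TriangularParts.next {π : T.Face → Q} (hπ : TriangularParts π)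
    (d : crossing π) : crossing π := Classical.choose (hπ.exists_next d)

section

variable {π : T.Face → Q} (hπ : TriangularParts π)

lemma TriangularParts.part_next (d : crossing π) :
    π (T.face (hπ.next d).1) = π (T.face d.1) := (Classical.choose_spec (hπ.exists_next d)).1

lemma TriangularParts.next_fst (d : crossing π) : (hπ.next d).1.fst = d.1.snd :=
  (Classical.choose_spec (hπ.exists_next d)).2

lemma TriangularParts.eq_next {d e : crossing π} (h : π (T.face e.1) = π (T.face d.1))
    (h' : e.1.fst = d.1.snd) : e = hπ.next d :=
  Subtype.ext (hπ.eq_of_fst_eq e.2 (hπ.next d).2 (h.trans (hπ.part_next d).symm)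
    (h'.trans (hπ.next_fst d).symm))

lemma TriangularParts.next_next_next (d : crossing π) :
    hπ.next (hπ.next (hπ.next d)) = d := by
  obtain ⟨e, g, he, hg, h₁, h₂, -, h₃, h₄, h₅, -⟩ := hπ.triangle d.2
  have h₆ : ⟨e, he⟩ = hπ.next d := hπ.eq_next h₁ h₃
  have h₇ : ⟨g, hg⟩ = hπ.next ⟨e, he⟩ := hπ.eq_next (h₂.trans h₁.symm) h₄
  rw [← h₆, ← h₇]
  exact (hπ.eq_next h₂.symm h₅.symm).symm

lemma TriangularParts.eq_or_of_part_eq {d e : crossing π}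
    (h : π (T.face e.1) = π (T.face d.1)) :
    e = d ∨ e = hπ.next d ∨ e = hπ.next (hπ.next d) := by
  obtain ⟨x, g, hx, hg, h₁, h₂, hall, h₃, h₄, -, -⟩ := hπ.triangle d.2
  have h₆ : ⟨x, hx⟩ = hπ.next d := hπ.eq_next h₁ h₃
  have h₇ : ⟨g, hg⟩ = hπ.next ⟨x, hx⟩ := hπ.eq_next (h₂.trans h₁.symm) h₄
  rw [← h₆, ← h₇]
  simpa [Subtype.ext_iff] using hall e.1 e.2 h

/-- The vertices of the triangulation obtained by contracting the parts to single faces. -/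
abbrev ContractVertex (π : T.Face → Q) : Type u := {v : V // ∃ d ∈ crossing π, d.fst = v}

/-- The graph formed by the edges between different parts. -/
def contractGraph (π : T.Face → Q) : SimpleGraph (ContractVertex π) where
  Adj u w := ∃ d ∈ crossing π, d.fst = u.1 ∧ d.snd = w.1
  symm := ⟨by
    rintro u w ⟨d, hd, h₁, h₂⟩
    exact ⟨d.symm, symm_mem_crossing hd, h₂, h₁⟩⟩
  loopless := ⟨by
    rintro u ⟨d, hd, h₁, h₂⟩
    exact d.fst_ne_snd (h₁.trans h₂.symm)⟩

lemma exists_crossing (x : (contractGraph π).Dart) :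
    ∃ d : crossing π, d.1.fst = x.fst.1 ∧ d.1.snd = x.snd.1 := by
  obtain ⟨d, hd, h⟩ := x.adj
  exact ⟨⟨d, hd⟩, h⟩

/-- The darts of the contracted graph are the crossing darts. -/
noncomputable def contractDart (π : T.Face → Q) : (contractGraph π).Dart ≃ crossing π where
  toFun x := Classical.choose (exists_crossing x)
  invFun d := ⟨(⟨d.1.fst, d.1, d.2, rfl⟩, ⟨d.1.snd, d.1.symm, symm_mem_crossing d.2, rfl⟩),
    d.1, d.2, rfl, rfl⟩
  left_inv x := by
    have h := Classical.choose_spec (exists_crossing x)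
    exact SimpleGraph.Dart.ext _ _ (Prod.ext (Subtype.ext h.1) (Subtype.ext h.2))
  right_inv d := by
    have h := Classical.choose_spec (exists_crossing (π := π)
      ⟨(⟨d.1.fst, d.1, d.2, rfl⟩, ⟨d.1.snd, d.1.symm, symm_mem_crossing d.2, rfl⟩),
        d.1, d.2, rfl, rfl⟩)
    exact Subtype.ext (T.dart_ext h.1 h.2)

lemma contractDart_fst (x : (contractGraph π).Dart) : (contractDart π x).1.fst = x.fst.1 :=
  (Classical.choose_spec (exists_crossing x)).1

lemma contractDart_snd (x : (contractGraph π).Dart) : (contractDart π x).1.snd = x.snd.1 :=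
  (Classical.choose_spec (exists_crossing x)).2

lemma contractDart_symm (x : (contractGraph π).Dart) :
    contractDart π x.symm =
      ⟨(contractDart π x).1.symm, symm_mem_crossing (contractDart π x).2⟩ := by
  refine Subtype.ext (T.dart_ext ?_ ?_)
  · rw [contractDart_fst]
    exact (contractDart_snd x).symm
  · rw [contractDart_snd]
    exact (contractDart_fst x).symm

/-- The successor along the boundary of a part, as a permutation of the darts of the contracted
graph. -/
noncomputable def TriangularParts.nextPerm : Equiv.Perm (contractGraph π).Dart where
  toFun x := (contractDart π).symm (hπ.next (contractDart π x))
  invFun x := (contractDart π).symm (hπ.next (hπ.next (contractDart π x)))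
  left_inv x := by simp [hπ.next_next_next]
  right_inv x := by simp [hπ.next_next_next]

lemma TriangularParts.contractDart_nextPerm (x : (contractGraph π).Dart) :
    contractDart π (hπ.nextPerm x) = hπ.next (contractDart π x) := by
  simp [TriangularParts.nextPerm]

lemma TriangularParts.nextPerm_fst (x : (contractGraph π).Dart) :
    (hπ.nextPerm x).fst = x.snd := by
  apply Subtype.ext
  rw [← contractDart_fst, hπ.contractDart_nextPerm, hπ.next_fst, contractDart_snd]

/-- The contraction of the parts to single faces, as a rotation system.  The rotation at a vertex
is the one inherited from `T`. -/
noncomputable def TriangularParts.rotationSystem : RotationSystem (ContractVertex π) where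
  graph := contractGraph π
  rot := (SimpleGraph.Dart.symm_involutive (G := contractGraph π)).toPerm.trans hπ.nextPerm
  rot_fst d := hπ.nextPerm_fst d.symm
  rot_cyclic x y hxy := by
    set rot : Equiv.Perm (contractGraph π).Dart :=
      (SimpleGraph.Dart.symm_involutive (G := contractGraph π)).toPerm.trans hπ.nextPerm
    have hrot : ∀ z, contractDart π (rot z) = hπ.next (contractDart π z.symm) :=
      fun z => hπ.contractDart_nextPerm z.symm
    have hd : (contractDart π x).1.fst = (contractDart π y).1.fst := by
      rw [contractDart_fst, contractDart_fst, hxy]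
    -- Walk around the vertex in `T`; `z` is the last crossing dart that was met.
    have key : ∀ n : ℕ, ∃ z, rot.SameCycle x z ∧ z.fst = x.fst ∧
        ((T.rot ^ n) (contractDart π x).1 = (contractDart π z).1 ∨
          π (T.face ((T.rot ^ n) (contractDart π x).1)) =
            π (T.face (contractDart π z).1.symm)) ∧
        ((T.rot ^ n) (contractDart π x).1).fst = x.fst.1 := by
      intro n
      induction n with
      | zero => exact ⟨x, Equiv.Perm.SameCycle.refl _ _, rfl, Or.inl rfl, contractDart_fst x⟩
      | succ n ih =>
        obtain ⟨z, hz, hzx, h, hfst⟩ := ih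
        rw [pow_succ', Equiv.Perm.mul_apply]
        set e := (T.rot ^ n) (contractDart π x).1
        have hfst' : (T.rot e).fst = x.fst.1 := (T.rot_fst e).trans hfst
        by_cases he : e ∈ crossing π
        · -- at a crossing dart the invariant starts afresh
          suffices h' : ∃ z, rot.SameCycle x z ∧ z.fst = x.fst ∧ e = (contractDart π z).1 by
            obtain ⟨z, hz, hzx, h⟩ := h'
            exact ⟨z, hz, hzx, Or.inr (by rw [face_rot, h]), hfst'⟩
          rcases h with h | h
          · exact ⟨z, hz, hzx, h⟩
          · refine ⟨rot z, Equiv.Perm.sameCycle_apply_right.2 hz,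
              (hπ.nextPerm_fst z.symm).trans hzx, ?_⟩
            rw [hrot]
            refine congrArg Subtype.val (hπ.eq_next (e := ⟨e, he⟩) ?_ ?_)
            · rw [contractDart_symm]
              exact h
            · rw [contractDart_snd]
              exact hfst.trans (congrArg Subtype.val hzx.symm)
        · have he' : π (T.face e) = π (T.face e.symm) := not_not.1 he
          refine ⟨z, hz, hzx, Or.inr ?_, hfst'⟩
          rw [face_rot, ← he']
          rcases h with h | h
          · exact absurd (h ▸ (contractDart π z).2) he
          · exact h
    obtain ⟨n, -, hn⟩ := (T.rot_cyclic _ _ hd).exists_pow_eq'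
    obtain ⟨z, hz, hzx, h, -⟩ := key n
    rw [hn] at h
    rcases h with h | h
    · have : y = z := (contractDart π).injective (Subtype.ext h)
      exact this ▸ hz
    · have : y = rot z := by
        refine (contractDart π).injective ?_
        rw [hrot]
        refine hπ.eq_next ?_ ?_
        · rw [contractDart_symm]
          exact h
        · rw [contractDart_snd, contractDart_fst, ← hxy, ← hzx]
          rfl
      exact this ▸ Equiv.Perm.sameCycle_apply_right.2 hz

/-- The darts of the contraction are the crossing darts of `T`. -/
noncomputable def TriangularParts.dart : hπ.rotationSystem.graph.Dart ≃ crossing π :=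
  contractDart π

lemma TriangularParts.dart_fst (x : hπ.rotationSystem.graph.Dart) :
    (hπ.dart x).1.fst = x.fst.1 := contractDart_fst x

lemma TriangularParts.dart_snd (x : hπ.rotationSystem.graph.Dart) :
    (hπ.dart x).1.snd = x.snd.1 := contractDart_snd x

lemma TriangularParts.dart_symm (x : hπ.rotationSystem.graph.Dart) :
    hπ.dart x.symm = ⟨(hπ.dart x).1.symm, symm_mem_crossing (hπ.dart x).2⟩ := contractDart_symm x

lemma TriangularParts.dart_faceNext (x : hπ.rotationSystem.graph.Dart) :
    hπ.dart (hπ.rotationSystem.faceNext x) = hπ.next (hπ.dart x) := by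
  have h₁ : hπ.rotationSystem.faceNext x = hπ.nextPerm x.symm.symm := rfl
  have h₂ : hπ.dart (hπ.nextPerm x) = hπ.next (hπ.dart x) := hπ.contractDart_nextPerm x
  rw [h₁, SimpleGraph.Dart.symm_symm, h₂]

lemma TriangularParts.triangular : hπ.rotationSystem.Triangular := fun x =>
  hπ.dart.injective <| by
    rw [hπ.dart_faceNext, hπ.dart_faceNext, hπ.dart_faceNext,
      hπ.next_next_next]

/-- The part that is contracted to a given face. -/
noncomputable def TriangularParts.part (g : hπ.rotationSystem.Face) : Q :=
  π (T.face (hπ.dart (Classical.choose (hπ.rotationSystem.exists_face_eq g))).1)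

lemma TriangularParts.part_face (x : hπ.rotationSystem.graph.Dart) :
    hπ.part (hπ.rotationSystem.face x) = π (T.face (hπ.dart x).1) := by
  have h := Classical.choose_spec (hπ.rotationSystem.exists_face_eq (hπ.rotationSystem.face x))
  unfold TriangularParts.part
  rcases hπ.triangular.face_eq_iff.1 h with h | h | h <;> rw [h]
  · rw [hπ.dart_faceNext, hπ.part_next]
  · rw [hπ.dart_faceNext, hπ.part_next, hπ.dart_faceNext, hπ.part_next]

lemma TriangularParts.part_injective : Function.Injective hπ.part := by
  intro g h hgh
  obtain ⟨x, rfl⟩ := hπ.rotationSystem.exists_face_eq g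
  obtain ⟨y, rfl⟩ := hπ.rotationSystem.exists_face_eq h
  rw [hπ.part_face, hπ.part_face] at hgh
  refine hπ.triangular.face_eq_iff.2 ?_
  simpa only [← hπ.dart.injective.eq_iff, hπ.dart_faceNext] using
    hπ.eq_or_of_part_eq hgh

lemma TriangularParts.exists_crossing_part (hπ : TriangularParts π) (p : T.Face) :
    ∃ x, π (T.face (hπ.dart x).1) = π p := by
  have h : (T.bd (π ⁻¹' {π p})).Nonempty := by
    refine Set.nonempty_of_ncard_ne_zero ?_
    rw [hπ p]
    norm_num
  obtain ⟨d, hd⟩ := h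
  rw [mem_bd_fiber] at hd
  exact ⟨hπ.dart.symm ⟨d, hd.1⟩, by simpa using hd.2⟩

lemma TriangularParts.exists_part_eq (p : T.Face) : ∃ g, hπ.part g = π p := by
  obtain ⟨x, hx⟩ := hπ.exists_crossing_part p
  exact ⟨hπ.rotationSystem.face x, by rw [hπ.part_face, hx]⟩

lemma TriangularParts.exists_eq_part (g : hπ.rotationSystem.Face) : ∃ p, π p = hπ.part g :=
  ⟨_, rfl⟩

/-- The contracted graph is connected because the dual graph of `T` is. -/
lemma TriangularParts.connected (hne : Nonempty T.Face) : hπ.rotationSystem.graph.Connected := by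
  obtain ⟨p₀⟩ := hne
  obtain ⟨x₀, -⟩ := hπ.exists_crossing_part p₀
  have hadj : ∀ x : hπ.rotationSystem.graph.Dart, hπ.rotationSystem.graph.Reachable x.fst x.snd :=
    fun x => x.adj.reachable
  have hpart : ∀ x y : hπ.rotationSystem.graph.Dart,
      π (T.face (hπ.dart y).1) = π (T.face (hπ.dart x).1) →
        hπ.rotationSystem.graph.Reachable x.fst y.fst := by
    intro x y h
    have h' := hπ.eq_or_of_part_eq h
    simp only [← hπ.dart_faceNext, hπ.dart.injective.eq_iff] at h'
    rcases h' with rfl | rfl | rfl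
    · exact SimpleGraph.Reachable.refl _
    · rw [faceNext_fst]
      exact hadj x
    · rw [faceNext_fst]
      refine (hadj x).trans ?_
      rw [← faceNext_fst]
      exact hadj _
  let B : Set T.Face := {p | ∀ x : hπ.rotationSystem.graph.Dart,
    π (T.face (hπ.dart x).1) = π p → hπ.rotationSystem.graph.Reachable x₀.fst x.fst}
  have hB : B = Set.univ := by
    refine eq_univ_of_bd_eq_empty T.connected ⟨T.face (hπ.dart x₀).1, hpart x₀⟩ ?_
    rw [Set.eq_empty_iff_forall_notMem]
    rintro d ⟨hd, hd'⟩
    have hcross : d ∈ crossing π := by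
      intro h
      refine hd' fun x hx => hd x (hx.trans h.symm)
    refine hd' fun x hx => ?_
    set z := hπ.dart.symm ⟨d, hcross⟩ with hz
    have hz' : hπ.dart z = ⟨d, hcross⟩ := by simp [hz]
    refine ((hd z (by rw [hz'])).trans (hadj z)).trans ?_
    refine hpart z.symm x ?_
    rw [hπ.dart_symm, hz', hx]
  refine { preconnected := ?_, nonempty := ⟨x₀.fst⟩ }
  have key : ∀ w : ContractVertex π, hπ.rotationSystem.graph.Reachable x₀.fst w := by
    intro w
    obtain ⟨d, hd, hdw⟩ := w.2
    have h : T.face d ∈ B := hB ▸ Set.mem_univ _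
    have h' := h (hπ.dart.symm ⟨d, hd⟩) (by simp)
    have : (hπ.dart.symm ⟨d, hd⟩).fst = w := Subtype.ext hdw
    rwa [this] at h'
  exact fun v w => (key v).symm.trans (key w)

/-- Euler's formula for the contracted graph: a cocycle modulo 2 on it extends to a cocycle of `T`,
as inside each part it is the coboundary of a function defined on the boundary of the part. -/
lemma TriangularParts.euler (hne : Nonempty T.Face) :
    Nat.card (ContractVertex π) + Nat.card hπ.rotationSystem.Face =
      Nat.card hπ.rotationSystem.graph.edgeSet + 2 := by
  classical
  have hne' : Nonempty hπ.rotationSystem.Face := ⟨(hπ.exists_part_eq hne.some).choose⟩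
  rw [hπ.triangular.euler_iff_dart (hπ.connected hne) hne']
  intro x hsymm hsum
  have h2 : ∀ a : ZMod 2, a + a = 0 := CharTwo.add_self_eq_zero
  -- transport `x` to the crossing darts of `T`
  obtain ⟨w, hw⟩ : ∃ w : crossing π → ZMod 2, ∀ z, w (hπ.dart z) = x z :=
    ⟨fun d => x (hπ.dart.symm d), fun z => by simp⟩
  have hwsymm : ∀ d : crossing π, w ⟨d.1.symm, symm_mem_crossing d.2⟩ = w d := by
    intro d
    obtain ⟨z, rfl⟩ := hπ.dart.surjective d
    rw [← hπ.dart_symm, hw, hw]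
    exact hsymm z
  have hwsum : ∀ d : crossing π, w d + w (hπ.next d) + w (hπ.next (hπ.next d)) = 0 := by
    intro d
    obtain ⟨z, rfl⟩ := hπ.dart.surjective d
    rw [← hπ.dart_faceNext, ← hπ.dart_faceNext, hw, hw, hw]
    exact hsum z
  -- a potential along the boundary of each part
  have hpot : ∀ q : Q, ∃ y : V → ZMod 2, ∀ d : crossing π, π (T.face d.1) = q →
      w d = y d.1.fst + y d.1.snd := by
    intro q
    by_cases hq : ∃ d : crossing π, π (T.face d.1) = q
    swap
    · exact ⟨0, fun d hd => (hq ⟨d, hd⟩).elim⟩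
    obtain ⟨d, rfl⟩ := hq
    have hn₁ : (hπ.next d).1.fst = d.1.snd := hπ.next_fst d
    have hn₂ : (hπ.next (hπ.next d)).1.fst = (hπ.next d).1.snd := hπ.next_fst _
    have hn₃ : (hπ.next (hπ.next d)).1.snd = d.1.fst := by
      rw [← hπ.next_fst, hπ.next_next_next]
    have hne₁ : d.1.fst ≠ d.1.snd := d.1.fst_ne_snd
    have hne₂ : (hπ.next d).1.snd ≠ d.1.snd := by
      rw [← hn₁]; exact (hπ.next d).1.snd_ne_fst
    have hne₃ : d.1.fst ≠ (hπ.next d).1.snd := by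
      rw [← hn₂, ← hn₃]; exact (hπ.next (hπ.next d)).1.snd_ne_fst
    refine ⟨fun v => if v = d.1.snd then w d else
      if v = (hπ.next d).1.snd then w (hπ.next (hπ.next d)) else 0, fun e he => ?_⟩
    rcases hπ.eq_or_of_part_eq he with rfl | rfl | rfl
    · simp [hne₁, hne₃]
    · simp only [hn₁, hne₂, if_true, if_false]
      linear_combination hwsum d - h2 (w d) - h2 (w (hπ.next (hπ.next d)))
    · simp [hn₂, hn₃, hne₁, hne₂, hne₃]
  choose Y hY using hpot
  let X : T.graph.Dart → ZMod 2 := fun d => Y (π (T.face d)) d.fst + Y (π (T.face d)) d.snd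
  have hXw : ∀ d : crossing π, X d.1 = w d := fun d => (hY _ d rfl).symm
  obtain ⟨y, hy⟩ := (T.isTriangular.euler_iff_dart T.connected hne).1 T.euler X
    (fun d => by
      by_cases hd : d ∈ crossing π
      · exact (hXw ⟨d.symm, symm_mem_crossing hd⟩).trans
          ((hwsymm ⟨d, hd⟩).trans (hXw ⟨d, hd⟩).symm)
      · have hd' : π (T.face d) = π (T.face d.symm) := not_not.1 hd
        change Y (π (T.face d.symm)) d.snd + Y (π (T.face d.symm)) d.fst = _
        rw [← hd', add_comm])
    (fun d => by
      simp only [X, face_faceNext, T.isTriangular.snd_faceNext_faceNext, faceNext_fst]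
      linear_combination h2 (Y (π (T.face d)) d.fst) + h2 (Y (π (T.face d)) d.snd) +
        h2 (Y (π (T.face d)) (T.faceNext d).snd))
  refine ⟨fun v => y v.1, fun z => ?_⟩
  rw [← hw, ← hXw, hy, hπ.dart_fst, hπ.dart_snd]

/-- The plane triangulation obtained from `T` by contracting each part to a single face. -/
noncomputable def TriangularParts.contract (hne : Nonempty T.Face) :
    PlaneTriangulation (ContractVertex π) where
  toRotationSystem := hπ.rotationSystem
  connected := hπ.connected hne
  euler := hπ.euler hne
  triangular := hπ.triangular

variable (hne : Nonempty T.Face)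

/-- The boundary of a set of contracted faces is the boundary of the union of the parts. -/
lemma TriangularParts.image_bd (A : Set Q) :
    (fun x => (hπ.dart x).1) '' hπ.rotationSystem.bd (hπ.part ⁻¹' A) =
      T.bd (π ⁻¹' A) := by
  ext d
  constructor
  · rintro ⟨x, ⟨h₁, h₂⟩, rfl⟩
    rw [Set.mem_preimage, hπ.part_face] at h₁
    rw [Set.mem_preimage] at h₂
    rw [hπ.part_face, hπ.dart_symm] at h₂
    exact ⟨h₁, h₂⟩
  · rintro ⟨h₁, h₂⟩
    have hd : d ∈ crossing π := fun h => by
      rw [Set.mem_preimage] at h₁ h₂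
      exact h₂ (h ▸ h₁)
    refine ⟨hπ.dart.symm ⟨d, hd⟩, ⟨?_, ?_⟩, by simp⟩
    · rw [Set.mem_preimage, hπ.part_face]
      simpa using h₁
    · rw [Set.mem_preimage]
      rw [hπ.part_face, hπ.dart_symm]
      simpa using h₂

lemma TriangularParts.ncard_bd (A : Set Q) :
    (hπ.rotationSystem.bd (hπ.part ⁻¹' A)).ncard = (T.bd (π ⁻¹' A)).ncard := by
  rw [← hπ.image_bd]
  refine (Set.ncard_image_of_injective _ ?_).symm
  exact Subtype.val_injective.comp hπ.dart.injective

lemma TriangularParts.image_faceVerts (g : hπ.rotationSystem.Face) :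
    Subtype.val '' hπ.rotationSystem.faceVerts g =
      {v | ∃ d ∈ T.bd (π ⁻¹' {hπ.part g}), d.fst = v} := by
  ext v
  constructor
  · rintro ⟨w, ⟨x, rfl, rfl⟩, rfl⟩
    refine ⟨(hπ.dart x).1, mem_bd_fiber.2 ⟨(hπ.dart x).2, ?_⟩, hπ.dart_fst x⟩
    exact (hπ.part_face x).symm
  · rintro ⟨d, hd, rfl⟩
    rw [mem_bd_fiber] at hd
    refine ⟨⟨d.fst, d, hd.1, rfl⟩, ⟨hπ.dart.symm ⟨d, hd.1⟩, ?_, rfl⟩, rfl⟩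
    apply hπ.part_injective
    refine (hπ.part_face _).trans ?_
    simpa using hd.2

end

end PlaneTriangulation

/-! ### Tutte's theorem in the dual graph -/

/-- Tutte's theorem for the subgraph induced on the complement of `X`, in terms of sets of
vertices: either there is a perfect matching `m`, or there are a set `S` and at least `|S| + 2`
disjoint sets without edges to the rest of the complement of `S`. -/
lemma SimpleGraph.exists_matching_or_barrier {F : Type u} [Finite F] (G : SimpleGraph F)
    (X : Set F) (heven : Even Xᶜ.ncard) :
    (∃ m : F → F → Prop, (∀ p q, m p q → m q p) ∧ (∀ p q, m p q → G.Adj p q ∧ p ∉ X ∧ q ∉ X) ∧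
      ∀ p, p ∉ X → ∃! q, m p q) ∨
    ∃ (S : Set F) (ι : Type u) (_ : Finite ι) (K : ι → Set F), S ⊆ Xᶜ ∧
      (∀ i, (K i).Nonempty) ∧ (∀ i, ∀ p ∈ K i, p ∉ X ∧ p ∉ S) ∧
      (∀ i j p, p ∈ K i → p ∈ K j → i = j) ∧
      (∀ i, ∀ p ∈ K i, ∀ q, G.Adj p q → q ∉ X → q ∉ S → q ∈ K i) ∧
      S.ncard + 2 ≤ Nat.card ι := by
  classical
  by_cases h : ∃ M : SimpleGraph.Subgraph (G.induce Xᶜ), M.IsPerfectMatching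
  · left
    obtain ⟨M, hM⟩ := h
    rw [SimpleGraph.Subgraph.isPerfectMatching_iff] at hM
    refine ⟨fun p q => ∃ (hp : p ∈ Xᶜ) (hq : q ∈ Xᶜ), M.Adj ⟨p, hp⟩ ⟨q, hq⟩, ?_, ?_, ?_⟩
    · rintro p q ⟨hp, hq, h⟩
      exact ⟨hq, hp, h.symm⟩
    · rintro p q ⟨hp, hq, h⟩
      exact ⟨M.adj_sub h, hp, hq⟩
    · intro p hp
      obtain ⟨q, hq, huniq⟩ := hM ⟨p, hp⟩
      refine ⟨q.1, ⟨hp, q.2, hq⟩, ?_⟩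
      rintro r ⟨hp', hr, hpr⟩
      exact congrArg Subtype.val (huniq ⟨r, hr⟩ hpr)
  · right
    rw [SimpleGraph.tutte] at h
    push Not at h
    obtain ⟨u, hu⟩ := h
    unfold SimpleGraph.IsTutteViolator at hu
    set C := ((⊤ : (G.induce Xᶜ).Subgraph).deleteVerts u).coe with hC
    have hS : (Subtype.val '' u : Set F).ncard = u.ncard :=
      Set.ncard_image_of_injective _ Subtype.val_injective
    have hmem : ∀ (p : F) (hp : p ∈ Xᶜ), p ∉ (Subtype.val '' u : Set F) →
        (⟨p, hp⟩ : (Xᶜ : Set F)) ∈ ((⊤ : (G.induce Xᶜ).Subgraph).deleteVerts u).verts := by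
      intro p hp hpu
      simp only [SimpleGraph.Subgraph.deleteVerts_verts, SimpleGraph.Subgraph.verts_top,
        Set.mem_sdiff, Set.mem_univ, true_and]
      exact fun h => hpu ⟨_, h, rfl⟩
    have hnot : ∀ x : ((⊤ : (G.induce Xᶜ).Subgraph).deleteVerts u).verts,
        x.1.1 ∉ (Subtype.val '' u : Set F) := by
      rintro ⟨⟨p, hp⟩, hx⟩ ⟨y, hy, hyp⟩
      have : y = ⟨p, hp⟩ := Subtype.ext hyp
      subst this
      exact hx.2 hy
    refine ⟨Subtype.val '' u, C.oddComponents, inferInstance,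
      fun c => {p | ∃ x, C.connectedComponentMk x = c.1 ∧ x.1.1 = p}, ?_, ?_, ?_, ?_, ?_, ?_⟩
    · rintro _ ⟨x, -, rfl⟩
      exact x.2
    · rintro ⟨c, -⟩
      induction c using SimpleGraph.ConnectedComponent.ind with
      | _ x => exact ⟨x.1.1, x, rfl, rfl⟩
    · rintro c _ ⟨x, -, rfl⟩
      exact ⟨x.1.2, hnot x⟩
    · rintro c d _ ⟨x, hx, rfl⟩ ⟨y, hy, hyx⟩
      have : y = x := Subtype.ext (Subtype.ext hyx)
      subst this
      exact Subtype.ext (hx.symm.trans hy)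
    · rintro c _ ⟨x, hx, rfl⟩ q hadj hq hqu
      refine ⟨⟨⟨q, hq⟩, hmem q hq hqu⟩, ?_, rfl⟩
      rw [← hx]
      refine (SimpleGraph.ConnectedComponent.sound (SimpleGraph.Adj.reachable ?_)).symm
      rw [hC, SimpleGraph.Subgraph.coe_adj, SimpleGraph.Subgraph.deleteVerts_adj]
      exact ⟨trivial, x.2.2, trivial, (hmem q hq hqu).2, hadj⟩
    · -- the number of odd components has the same parity as `|S|`
      have hodd := C.odd_ncard_oddComponents
      have hcard : Nat.card ((⊤ : (G.induce Xᶜ).Subgraph).deleteVerts u).verts + u.ncard =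
          Xᶜ.ncard := by
        have h₁ : ((⊤ : (G.induce Xᶜ).Subgraph).deleteVerts u).verts = uᶜ := by
          ext x
          simp
        rw [h₁, Nat.card_coe_set_eq, add_comm, Set.ncard_add_ncard_compl, Nat.card_coe_set_eq]
      rw [hS]
      rw [Nat.card_coe_set_eq]
      rw [Nat.even_iff] at heven
      rw [Nat.odd_iff, Nat.odd_iff] at hodd
      omega

namespace PlaneTriangulation

variable {V : Type u} [Finite V] {T : PlaneTriangulation V}

lemma eq_of_face_eq (hcard : 3 ≤ Nat.card T.Face) {d e : T.graph.Dart}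
    (h₁ : T.face d = T.face e) (h₂ : T.face d.symm = T.face e.symm) : d = e := by
  by_contra hne
  set A : Set T.Face := {T.face d, T.face d.symm} with hA
  have hAcard : A.ncard = 2 := Set.ncard_pair (T.isTriangular.face_symm_ne d).symm
  have hAuniv : A ≠ Set.univ := by
    intro h
    rw [h, Set.ncard_univ] at hAcard
    omega
  have h₃ := T.three_le_ncard_bd (A := A) ⟨_, Or.inl rfl⟩ hAuniv
  have h₄ := T.isTriangular.ncard_face_mem A
  have hes : ∀ x y : T.graph.Dart, T.face x = T.face y → x ≠ y.symm := by
    rintro x y h rfl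
    exact T.isTriangular.face_symm_ne y h
  have h₅ : ({d, e, d.symm, e.symm} : Set T.graph.Dart).ncard = 4 := by
    rw [Set.ncard_insert_of_notMem, Set.ncard_insert_of_notMem, Set.ncard_pair]
    · exact fun h => hne (SimpleGraph.Dart.symm_involutive.injective h)
    · simp only [Set.mem_insert_iff, Set.mem_singleton_iff, not_or]
      exact ⟨hes _ _ h₁.symm, e.symm_ne.symm⟩
    · simp only [Set.mem_insert_iff, Set.mem_singleton_iff, not_or]
      exact ⟨hne, d.symm_ne.symm, hes _ _ h₁⟩
  have h₆ : T.bd A ∪ {d, e, d.symm, e.symm} ⊆ {x | T.face x ∈ A} := by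
    rintro x (hx | rfl | rfl | rfl | rfl)
    · exact hx.1
    · exact Or.inl rfl
    · exact Or.inl h₁.symm
    · exact Or.inr rfl
    · exact Or.inr h₂.symm
  have h₇ : Disjoint (T.bd A) {d, e, d.symm, e.symm} := by
    rw [Set.disjoint_left]
    rintro x ⟨-, hx⟩ (rfl | rfl | rfl | rfl)
    · exact hx (Or.inr rfl)
    · exact hx (Or.inr h₂.symm)
    · exact hx (Or.inl (by simp))
    · exact hx (Or.inl (by simp [h₁]))
  have h₈ := Set.ncard_le_ncard h₆ (Set.toFinite _)
  rw [Set.ncard_union_eq h₇, h₅, h₄] at h₈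
  omega

variable (T) in
lemma even_card_face : Even (Nat.card T.Face) := by
  classical
  have := Fintype.ofFinite T.graph.Dart
  have h₁ : Even (Nat.card T.graph.Dart) := by
    rw [← ZMod.natCast_eq_zero_iff_even, Nat.card_eq_fintype_card, Fintype.card,
      Finset.cast_card]
    refine Finset.sum_involution (fun d _ => d.symm) ?_ ?_ ?_ ?_
    · intro d _
      decide
    · intro d _ _
      exact d.symm_ne
    · intro d _
      exact Finset.mem_univ _
    · intro d _
      exact d.symm_symm
  have h₂ := T.isTriangular.ncard_face_mem Set.univ
  simp only [Set.mem_univ, Set.ofPred_true, Set.ncard_univ] at h₂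
  rw [h₂] at h₁
  exact (Nat.even_mul.1 h₁).resolve_left (by decide)

/-- The faces that share an edge with `f`. -/
def neighborFaces (f : T.Face) : Set T.Face :=
  {q | ∃ d : T.graph.Dart, T.face d = f ∧ T.face d.symm = q}

lemma mem_neighborFaces_symm {f : T.Face} {d : T.graph.Dart} (h : T.face d.symm = f) :
    T.face d ∈ neighborFaces f := ⟨d.symm, h, by simp⟩

lemma notMem_neighborFaces (f : T.Face) : f ∉ neighborFaces f := by
  rintro ⟨d, rfl, h⟩
  exact T.isTriangular.face_symm_ne d h

lemma ncard_neighborFaces (hcard : 3 ≤ Nat.card T.Face) (f : T.Face) :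
    (neighborFaces f).ncard = 3 := by
  rw [← T.isTriangular.ncard_face f]
  have : neighborFaces f = (fun d : T.graph.Dart => T.face d.symm) '' {d | T.face d = f} := rfl
  rw [this, Set.InjOn.ncard_image]
  rintro d hd e he h
  exact eq_of_face_eq hcard (Eq.trans hd (Eq.symm he)) h

/-- The graph whose vertices are the faces, two faces being adjacent if they share an edge. -/
def dual (T : PlaneTriangulation V) : SimpleGraph T.Face where
  Adj p q := ∃ d : T.graph.Dart, T.face d = p ∧ T.face d.symm = q
  symm := ⟨by
    rintro p q ⟨d, rfl, rfl⟩
    exact ⟨d.symm, rfl, by simp⟩⟩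
  loopless := ⟨fun p h => notMem_neighborFaces p h⟩

/-- A partition of the faces into a set `S` and further parts `K i` that are bounded by 3-cycles,
such that every boundary edge of a part leads to `S` and every edge of a face of `S` leads to
a part. -/
structure IsBarrier (S : Set T.Face) {ι : Type*} (K : ι → Set T.Face) : Prop where
  nonempty : ∀ i, (K i).Nonempty
  notMem : ∀ i, ∀ p ∈ K i, p ∉ S
  eq_of_mem : ∀ i j p, p ∈ K i → p ∈ K j → i = j
  symm_mem : ∀ i, ∀ d ∈ T.bd (K i), T.face d.symm ∈ S
  ncard_bd : ∀ i, (T.bd (K i)).ncard = 3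
  exists_symm_mem : ∀ d, T.face d ∈ S → ∃ i, T.face d.symm ∈ K i
  exists_mem : ∀ p, p ∉ S → ∃ i, p ∈ K i

/-- If disjoint sets of faces are separated from each other by a set `S` that is not larger than
their number, then counting the edges between them and `S` shows that they form a barrier. -/
lemma isBarrier_of_ncard_le {S : Set T.Face} (hS : S.Nonempty) {ι : Type*} [Finite ι]
    {K : ι → Set T.Face} (hK : ∀ i, (K i).Nonempty) (hKS : ∀ i, ∀ p ∈ K i, p ∉ S)
    (hdisj : ∀ i j p, p ∈ K i → p ∈ K j → i = j)
    (hbd : ∀ i, ∀ d ∈ T.bd (K i), T.face d.symm ∈ S) (hcard : S.ncard ≤ Nat.card ι) :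
    IsBarrier S K := by
  classical
  have := Fintype.ofFinite ι
  obtain ⟨s, hs⟩ := hS
  have h3 : ∀ i, 3 ≤ (T.bd (K i)).ncard := fun i =>
    T.three_le_ncard_bd (hK i) fun h => hKS i s (h ▸ Set.mem_univ s) hs
  let φ : (Σ i, T.bd (K i)) → {d : T.graph.Dart | T.face d ∈ S} :=
    fun x => ⟨x.2.1.symm, hbd x.1 x.2.1 x.2.2⟩
  have hφ : Function.Injective φ := by
    rintro ⟨i, d, hd⟩ ⟨j, e, he⟩ h
    have hde : d = e := SimpleGraph.Dart.symm_involutive.injective (congrArg Subtype.val h)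
    subst hde
    obtain rfl := hdisj i j _ hd.1 he.1
    rfl
  have hsum : Nat.card (Σ i, T.bd (K i)) = ∑ i, (T.bd (K i)).ncard := by
    rw [Nat.card_sigma]
    rfl
  have htot : Nat.card {d : T.graph.Dart | T.face d ∈ S} = 3 * S.ncard := by
    rw [Nat.card_coe_set_eq, T.isTriangular.ncard_face_mem]
  have h₁ : ∑ i, (T.bd (K i)).ncard ≤ 3 * S.ncard := by
    rw [← hsum, ← htot]
    exact Nat.card_le_card_of_injective φ hφ
  have h₂ : ∑ _i : ι, 3 = 3 * Nat.card ι := by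
    rw [Finset.sum_const, Finset.card_univ, Nat.card_eq_fintype_card, smul_eq_mul, mul_comm]
  have h₃ : ∑ _i : ι, 3 ≤ ∑ i, (T.bd (K i)).ncard := Finset.sum_le_sum fun i _ => h3 i
  have heq : ∑ _i : ι, 3 = ∑ i, (T.bd (K i)).ncard := by omega
  have hbd3 : ∀ i, (T.bd (K i)).ncard = 3 := fun i =>
    ((Finset.sum_eq_sum_iff_of_le fun i _ => h3 i).1 heq i (Finset.mem_univ i)).symm
  have hsurj : Function.Surjective φ :=
    (hφ.bijective_of_nat_card_le (by rw [htot, hsum]; omega)).surjective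
  have hex : ∀ d, T.face d ∈ S → ∃ i, T.face d.symm ∈ K i := by
    intro d hd
    obtain ⟨⟨i, e, he⟩, h⟩ := hsurj ⟨d, hd⟩
    have : e.symm = d := congrArg Subtype.val h
    refine ⟨i, ?_⟩
    rw [← this]
    simpa using he.1
  have hall : S ∪ {p | ∃ i, p ∈ K i} = Set.univ := by
    refine eq_univ_of_bd_eq_empty T.connected ⟨s, Or.inl hs⟩ ?_
    rw [Set.eq_empty_iff_forall_notMem]
    rintro d ⟨hd | ⟨i, hi⟩, hd'⟩
    · exact hd' (Or.inr (hex d hd))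
    · by_cases hdi : T.face d.symm ∈ K i
      · exact hd' (Or.inr ⟨i, hdi⟩)
      · exact hd' (Or.inl (hbd i d ⟨hi, hdi⟩))
  refine ⟨hK, hKS, hdisj, hbd, hbd3, hex, fun p hp => ?_⟩
  exact ((hall ▸ Set.mem_univ p : p ∈ S ∪ {p | ∃ i, p ∈ K i})).resolve_left hp

/-- Tutte's theorem in the dual graph without `f` and its neighbors, possibly with further edges:
either there is a perfect matching, or there is a barrier that has `f` as one of its parts. -/
lemma exists_matching_or_isBarrier (hcard : 3 ≤ Nat.card T.Face) (f : T.Face)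
    (R : SimpleGraph T.Face) :
    (∃ m : T.Face → T.Face → Prop, (∀ p q, m p q → m q p) ∧
      (∀ p q, m p q → (T.dual.Adj p q ∨ R.Adj p q) ∧ p ∉ insert f (neighborFaces f)) ∧
      ∀ p, p ∉ insert f (neighborFaces f) → ∃! q, m p q) ∨
    ∃ (S : Set T.Face) (ι : Type u) (K : ι → Set T.Face), IsBarrier S K ∧
      neighborFaces f ⊆ S ∧ (∃ i, K i = {f}) ∧
      ∀ i, ∀ p ∈ K i, p ≠ f → ∀ q, R.Adj p q → q ∉ S → q ≠ f → q ∈ K i := by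
  have hX : (insert f (neighborFaces f)).ncard = 4 := by
    rw [Set.ncard_insert_of_notMem (notMem_neighborFaces f), ncard_neighborFaces hcard]
  have heven : Even (insert f (neighborFaces f))ᶜ.ncard := by
    have h₁ := Set.ncard_add_ncard_compl (insert f (neighborFaces f))
    have h₂ := T.even_card_face
    rw [Nat.even_iff] at h₂ ⊢
    omega
  rcases (T.dual ⊔ R).exists_matching_or_barrier (insert f (neighborFaces f)) heven with
    ⟨m, h₁, h₂, h₃⟩ | ⟨S, ι, _, K, hSX, hK, hKX, hdisj, hadj, hle⟩
  · exact Or.inl ⟨m, h₁, fun p q h => ⟨(h₂ p q h).1, (h₂ p q h).2.1⟩, h₃⟩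
  · right
    have hfS : f ∉ S := fun h => hSX h (Set.mem_insert _ _)
    have hfN := notMem_neighborFaces f
    have hdisjSN : Disjoint S (neighborFaces f) := by
      rw [Set.disjoint_left]
      exact fun p hp hp' => hSX hp (Set.mem_insert_of_mem _ hp')
    have hnotf : ∀ i, f ∉ K i := fun i h => (hKX i f h).1 (Set.mem_insert _ _)
    refine ⟨S ∪ neighborFaces f, Option ι, fun i => i.elim {f} K, ?_,
      Set.subset_union_right, ⟨none, rfl⟩, ?_⟩
    · refine isBarrier_of_ncard_le ?_ ?_ ?_ ?_ ?_ ?_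
      · have : (neighborFaces f).Nonempty := by
          refine Set.nonempty_of_ncard_ne_zero ?_
          rw [ncard_neighborFaces hcard]
          norm_num
        exact this.mono Set.subset_union_right
      · rintro (_ | i)
        · exact ⟨f, rfl⟩
        · exact hK i
      · rintro (_ | i) p hp
        · have hp' : p = f := hp
          subst hp'
          exact fun h => h.elim hfS hfN
        · rintro (h | h)
          · exact (hKX i p hp).2 h
          · exact (hKX i p hp).1 (Set.mem_insert_of_mem _ h)
      · rintro (_ | i) (_ | j) p hp hp'
        · rfl
        · have hpf : p = f := hp
          exact absurd (hpf ▸ hp') (hnotf j)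
        · have hpf : p = f := hp'
          exact absurd (hpf ▸ hp) (hnotf i)
        · exact congrArg some (hdisj i j p hp hp')
      · rintro (_ | i) d ⟨hd, hd'⟩
        · exact Or.inr ⟨d, hd, rfl⟩
        · by_contra hcon
          rw [Set.mem_union, not_or] at hcon
          refine hd' (hadj i _ hd _ (Or.inl ⟨d, rfl, rfl⟩) ?_ hcon.1)
          rintro (h | h)
          · exact (hKX i _ hd).1 (Set.mem_insert_of_mem _ (mem_neighborFaces_symm h))
          · exact hcon.2 h
      · rw [Set.ncard_union_eq hdisjSN, ncard_neighborFaces hcard, Finite.card_option]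
        omega
    · rintro (_ | i) p hp hpf q hq hqS hqf
      · exact absurd hp hpf
      · rw [Set.mem_union, not_or] at hqS
        exact hadj i p hp q (Or.inr hq) (by simp [hqf, hqS.2]) hqS.1

/-- A matching of the faces off `Y`, except for those adjacent to `Y`, yields a coloring with `Y`
as set of monochromatic faces: the monochromatic edges are those along faces of `Y` and those
crossed by the matching. -/
lemma exists_coloring_of_matching (hcard : 3 ≤ Nat.card T.Face) (Y : Set T.Face)
    (m : T.Face → T.Face → Prop) (hsymm : ∀ p q, m p q → m q p)
    (hm : ∀ p q, m p q → T.dual.Adj p q)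
    (h : ∀ p, p ∉ Y → ((∃! d, T.face d = p ∧ T.face d.symm ∈ Y) ∧ ∀ q, ¬ m p q) ∨
      ((∀ d, T.face d = p → T.face d.symm ∉ Y) ∧ ∃! q, m p q)) :
    ∃ c : V → VertexColor, ∀ p, T.IsMonochromatic c p ↔ p ∈ Y := by
  let μ : T.graph.Dart → Prop := fun d =>
    T.face d ∈ Y ∨ T.face d.symm ∈ Y ∨ m (T.face d) (T.face d.symm)
  have huniq : ∀ p, p ∉ Y → ∃! d, T.face d = p ∧ μ d := by
    intro p hp
    rcases h p hp with ⟨⟨d, ⟨hd, hdY⟩, hu⟩, hn⟩ | ⟨hn, ⟨q, hq, hu⟩⟩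
    · refine ⟨d, ⟨hd, Or.inr (Or.inl hdY)⟩, ?_⟩
      rintro e ⟨he, he' | he' | he'⟩
      · exact absurd (he ▸ he') hp
      · exact hu e ⟨he, he'⟩
      · exact absurd (he ▸ he') (hn _)
    · obtain ⟨d, hd, hd'⟩ := hm p q hq
      refine ⟨d, ⟨hd, Or.inr (Or.inr (by rw [hd, hd']; exact hq))⟩, ?_⟩
      rintro e ⟨he, he' | he' | he'⟩
      · exact absurd (he ▸ he') hp
      · exact absurd he' (hn e he)
      · refine eq_of_face_eq hcard (he.trans hd.symm) ?_
        rw [hd']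
        exact hu _ (he ▸ he')
  obtain ⟨c, hc⟩ := T.exists_coloring μ
    (fun d hd => by
      rcases hd with hd | hd | hd
      · exact Or.inr (Or.inl (by simpa using hd))
      · exact Or.inl hd
      · exact Or.inr (Or.inr (by simpa using hsymm _ _ hd)))
    (fun p => by
      by_cases hp : p ∈ Y
      · exact Or.inr fun d hd => Or.inl (hd ▸ hp)
      · exact Or.inl (huniq p hp))
  refine ⟨c, fun p => ?_⟩
  simp only [isMonochromatic_iff, hc]
  constructor
  · intro hall
    by_contra hp
    obtain ⟨d, rfl⟩ := T.exists_face_eq p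
    have h₁ := (huniq _ hp).unique ⟨rfl, hall d rfl⟩
      (⟨T.face_faceNext d, hall (T.faceNext d) (by simp)⟩)
    exact faceNext_ne d h₁.symm
  · exact fun hp d hd => Or.inl (hd ▸ hp)

lemma existsUnique_dart_of_mem_neighborFaces (hcard : 3 ≤ Nat.card T.Face) {f p : T.Face}
    (hp : p ∈ neighborFaces f) : ∃! d, T.face d = p ∧ T.face d.symm = f := by
  obtain ⟨d, hd, hd'⟩ := hp
  refine ⟨d.symm, ⟨hd', by simpa using hd⟩, ?_⟩
  rintro e ⟨he, he'⟩
  exact eq_of_face_eq hcard (he.trans hd'.symm) (by simpa [hd] using he')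

/-- A perfect matching in the dual graph without `f` and its neighbors gives a coloring with `f`
as its only monochromatic face. -/
lemma exists_coloring_singleton (hcard : 3 ≤ Nat.card T.Face) {f : T.Face}
    {m : T.Face → T.Face → Prop} (hsymm : ∀ p q, m p q → m q p)
    (hm : ∀ p q, m p q → T.dual.Adj p q ∧ p ∉ insert f (neighborFaces f))
    (hmatch : ∀ p, p ∉ insert f (neighborFaces f) → ∃! q, m p q) :
    ∃ c : V → VertexColor, ∀ p, T.IsMonochromatic c p ↔ p = f := by
  refine exists_coloring_of_matching hcard {f} m hsymm (fun p q h => (hm p q h).1) fun p hp => ?_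
  by_cases hpN : p ∈ neighborFaces f
  · exact Or.inl ⟨existsUnique_dart_of_mem_neighborFaces hcard hpN,
      fun q hq => (hm p q hq).2 (Set.mem_insert_of_mem _ hpN)⟩
  · refine Or.inr ⟨fun d hd hd' => hpN ?_, hmatch p fun h => h.elim hp hpN⟩
    rw [← hd]
    exact mem_neighborFaces_symm hd'

/-- Either `f` is the only monochromatic face of some coloring, or `f` is a part of a barrier that
contains its neighbors. -/
lemma exists_coloring_or_isBarrier (hcard : 3 ≤ Nat.card T.Face) (f : T.Face) :
    (∃ c : V → VertexColor, ∀ p, T.IsMonochromatic c p ↔ p = f) ∨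
    ∃ (S : Set T.Face) (ι : Type u) (K : ι → Set T.Face), IsBarrier S K ∧
      neighborFaces f ⊆ S ∧ ∃ i, K i = {f} := by
  rcases exists_matching_or_isBarrier hcard f ⊥ with ⟨m, h₁, h₂, h₃⟩ | ⟨S, ι, K, h₁, h₂, h₃, -⟩
  · refine Or.inl (exists_coloring_singleton hcard h₁ (fun p q h => ⟨?_, (h₂ p q h).2⟩) h₃)
    simpa using (h₂ p q h).1
  · exact Or.inr ⟨S, ι, K, h₁, h₂, h₃⟩

/-- Some coloring has `f` and at most one further face as its monochromatic faces.  Tutte's theorem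
is applied to the dual graph without `f` and its neighbors, with one additional edge that joins
the other two neighbors of a neighbor `g` of `f`; if the additional edge is matched, then
`g` becomes monochromatic. -/
lemma exists_coloring_le_two (hcard : 3 ≤ Nat.card T.Face) (f : T.Face) :
    ∃ c : V → VertexColor, (∀ p, T.IsMonochromatic c p ↔ p = f) ∨
      ∃ g, g ≠ f ∧ ∀ p, T.IsMonochromatic c p ↔ p = f ∨ p = g := by
  obtain ⟨d₀, rfl⟩ := T.exists_face_eq f
  set f := T.face d₀ with hf
  set d₁ := d₀.symm with hd₁
  set d₂ := T.faceNext d₁ with hd₂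
  set d₃ := T.faceNext d₂ with hd₃
  set g := T.face d₁ with hg
  have hg₂ : T.face d₂ = g := by simp [hd₂, hg]
  have hg₃ : T.face d₃ = g := by simp [hd₃, hg₂]
  have hgf : g ≠ f := T.isTriangular.face_symm_ne d₀
  have hd₁f : T.face d₁.symm = f := by simp [hd₁, hf]
  have h₂₁ : d₂ ≠ d₁ := faceNext_ne d₁
  have h₃₁ : d₃ ≠ d₁ := T.isTriangular.faceNext_faceNext_ne d₁
  have h₃₂ : d₃ ≠ d₂ := faceNext_ne d₂
  have hgd : ∀ d, T.face d = g → d = d₁ ∨ d = d₂ ∨ d = d₃ :=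
    fun d hd => T.isTriangular.face_eq_iff.1 hd
  have hgN : g ∈ neighborFaces f := ⟨d₀, rfl, rfl⟩
  set a := T.face d₂.symm with ha
  set b := T.face d₃.symm with hb
  have hab : a ≠ b := fun h => h₃₂ (eq_of_face_eq hcard (hg₃.trans hg₂.symm) h.symm)
  have haf : a ≠ f := fun h => h₂₁ (eq_of_face_eq hcard hg₂ (h.trans hd₁f.symm))
  have hbf : b ≠ f := fun h => h₃₁ (eq_of_face_eq hcard hg₃ (h.trans hd₁f.symm))
  rcases exists_matching_or_isBarrier hcard f (SimpleGraph.edge a b) with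
    ⟨m, hsymm, hm, hmatch⟩ | ⟨S, ι, K, hB, hNS, ⟨i₀, hi₀⟩, hR⟩
  · by_cases hspec : m a b ∧ ¬ T.dual.Adj a b
    · obtain ⟨hmab, -⟩ := hspec
      have haX := (hm a b hmab).2
      have hbX := (hm b a (hsymm _ _ hmab)).2
      have haN : a ∉ neighborFaces f := fun h => haX (Set.mem_insert_of_mem _ h)
      have hbN : b ∉ neighborFaces f := fun h => hbX (Set.mem_insert_of_mem _ h)
      have hgX : g ∈ insert f (neighborFaces f) := Set.mem_insert_of_mem _ hgN
      have hag : a ≠ g := fun h => haX (h ▸ hgX)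
      have hbg : b ≠ g := fun h => hbX (h ▸ hgX)
      -- a face that is adjacent to `g` is one of `f`, `a`, `b`
      have hadj : ∀ d, T.face d.symm = g → T.face d = f ∨ d = d₂.symm ∨ d = d₃.symm := by
        intro d hd
        rcases hgd _ hd with h | h | h
        · left
          rw [← hd₁f, ← h, SimpleGraph.Dart.symm_symm]
        · right; left
          rw [← h, SimpleGraph.Dart.symm_symm]
        · right; right
          rw [← h, SimpleGraph.Dart.symm_symm]
      suffices h : ∃ c : V → VertexColor, ∀ p, T.IsMonochromatic c p ↔ p ∈ ({f, g} : Set T.Face) by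
        obtain ⟨c, hc⟩ := h
        exact ⟨c, Or.inr ⟨g, hgf, hc⟩⟩
      refine exists_coloring_of_matching hcard {f, g}
        (fun p q => m p q ∧ p ≠ a ∧ p ≠ b) ?_ ?_ ?_
      · rintro p q ⟨h, hpa, hpb⟩
        refine ⟨hsymm _ _ h, ?_, ?_⟩
        · rintro rfl
          exact hpb ((hmatch a haX).unique (hsymm _ _ h) hmab)
        · rintro rfl
          exact hpa ((hmatch b hbX).unique (hsymm _ _ h) (hsymm _ _ hmab))
      · rintro p q ⟨h, hpa, hpb⟩
        refine (hm p q h).1.resolve_right ?_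
        rw [SimpleGraph.edge_adj]
        tauto
      · intro p hp
        have hpf : p ≠ f := fun h => hp (Or.inl h)
        by_cases hpa : p = a
        · subst hpa
          refine Or.inl ⟨⟨d₂.symm, ⟨rfl, Or.inr (by simp [hg₂])⟩, ?_⟩, fun q hq => hq.2.1 rfl⟩
          rintro d ⟨hd, hd' | hd'⟩
          · exact absurd (hd ▸ mem_neighborFaces_symm hd') haN
          · rcases hadj d hd' with h | h | h
            · exact absurd (hd.symm.trans h) hpf
            · exact h
            · exact absurd (hd.symm.trans (h ▸ rfl)) hab
        by_cases hpb : p = b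
        · subst hpb
          refine Or.inl ⟨⟨d₃.symm, ⟨rfl, Or.inr (by simp [hg₃])⟩, ?_⟩, fun q hq => hq.2.2 rfl⟩
          rintro d ⟨hd, hd' | hd'⟩
          · exact absurd (hd ▸ mem_neighborFaces_symm hd') hbN
          · rcases hadj d hd' with h | h | h
            · exact absurd (hd.symm.trans h) hpf
            · exact absurd (hd.symm.trans (h ▸ rfl)) hab.symm
            · exact h
        have hpg : ∀ d, T.face d = p → T.face d.symm ≠ g := by
          intro d hd hd'
          rcases hadj d hd' with h | h | h
          · exact hpf (hd.symm.trans h)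
          · exact hpa (hd.symm.trans (h ▸ rfl))
          · exact hpb (hd.symm.trans (h ▸ rfl))
        by_cases hpN : p ∈ neighborFaces f
        · obtain ⟨d, ⟨hd, hd'⟩, hu⟩ := existsUnique_dart_of_mem_neighborFaces hcard hpN
          refine Or.inl ⟨⟨d, ⟨hd, Or.inl hd'⟩, ?_⟩,
            fun q hq => (hm p q hq.1).2 (Set.mem_insert_of_mem _ hpN)⟩
          rintro e ⟨he, he' | he'⟩
          · exact hu e ⟨he, he'⟩
          · exact absurd he' (hpg e he)
        · refine Or.inr ⟨?_, ?_⟩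
          · rintro d hd (hd' | hd')
            · exact hpN (hd ▸ mem_neighborFaces_symm hd')
            · exact hpg d hd hd'
          · obtain ⟨q, hq, hu⟩ := hmatch p fun h => h.elim hpf hpN
            exact ⟨q, ⟨hq, hpa, hpb⟩, fun r hr => hu r hr.1⟩
    · suffices h : ∃ c : V → VertexColor, ∀ p, T.IsMonochromatic c p ↔ p = f by
        obtain ⟨c, hc⟩ := h
        exact ⟨c, Or.inl hc⟩
      refine exists_coloring_singleton hcard hsymm (fun p q h => ⟨?_, (hm p q h).2⟩) hmatch
      · rcases (hm p q h).1 with h' | h'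
        · exact h'
        · rw [SimpleGraph.edge_adj] at h'
          by_contra hcon
          rcases h'.1 with ⟨rfl, rfl⟩ | ⟨rfl, rfl⟩
          · exact hspec ⟨h, hcon⟩
          · exact hspec ⟨hsymm _ _ h, fun h => hcon h.symm⟩
  · -- the part that contains `a` and `b` has only one edge that does not lead to `g`
    exfalso
    have hgS : g ∈ S := hNS hgN
    obtain ⟨i, hai⟩ := hB.exists_symm_mem d₂ (hg₂ ▸ hgS)
    obtain ⟨j, hbj⟩ := hB.exists_symm_mem d₃ (hg₃ ▸ hgS)
    have hbi : b ∈ K i := hR i a hai haf b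
      (by rw [SimpleGraph.edge_adj]; exact ⟨Or.inl ⟨rfl, rfl⟩, hab⟩) (hB.notMem j b hbj) hbf
    have hfi : f ∉ K i := by
      intro h
      have : i = i₀ := hB.eq_of_mem i i₀ f h (hi₀ ▸ rfl)
      rw [this, hi₀] at hai
      exact haf hai
    have hgi : g ∉ K i := fun h => hB.notMem i g h hgS
    have h3 := T.three_le_ncard_bd (A := insert g (K i)) ⟨g, Or.inl rfl⟩ fun h => by
      have : f ∈ insert g (K i) := h ▸ Set.mem_univ f
      exact this.elim (fun h => hgf h.symm) hfi
    have hsub : T.bd (insert g (K i)) ⊆ insert d₁ (T.bd (K i) \ {d₂.symm, d₃.symm}) := by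
      rintro d ⟨hd | hd, hd'⟩
      · rcases hgd d hd with rfl | rfl | rfl
        · exact Or.inl rfl
        · exact absurd (Or.inr hai) hd'
        · exact absurd (Or.inr hbi) hd'
      · refine Or.inr ⟨⟨hd, fun h => hd' (Or.inr h)⟩, ?_⟩
        rintro (rfl | rfl)
        · exact hd' (Or.inl (by simp [hg₂]))
        · exact hd' (Or.inl (by simp [hg₃]))
    have hpair : ({d₂.symm, d₃.symm} : Set T.graph.Dart).ncard = 2 :=
      Set.ncard_pair fun h => h₃₂ (SimpleGraph.Dart.symm_involutive.injective h).symm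
    have hpairsub : ({d₂.symm, d₃.symm} : Set T.graph.Dart) ⊆ T.bd (K i) := by
      rintro d (rfl | rfl)
      · exact ⟨hai, by simpa [hg₂] using hgi⟩
      · exact ⟨hbi, by simpa [hg₃] using hgi⟩
    have h₄ := Set.ncard_le_ncard hsub (Set.toFinite _)
    have h₅ := Set.ncard_insert_le d₁ (T.bd (K i) \ {d₂.symm, d₃.symm})
    have h₆ := Set.ncard_sdiff hpairsub (Set.toFinite _)
    rw [hpair, hB.ncard_bd] at h₆
    omega

end PlaneTriangulation

/-! ### Admissible partitions of the faces -/

namespace PlaneTriangulation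

variable {V : Type u} [Finite V] {T : PlaneTriangulation V}

lemma TriangularParts.isMonochromatic_iff {Q : Type*} {π : T.Face → Q} (hπ : TriangularParts π)
    (hne : Nonempty T.Face) (c : V → VertexColor) (g : (hπ.contract hne).Face) :
    (hπ.contract hne).IsMonochromatic (fun v => c v.1) g ↔
      ∃ k, ∀ d ∈ T.bd (π ⁻¹' {hπ.part g}), c d.fst = k := by
  refine exists_congr fun k => ?_
  have h := hπ.image_faceVerts g
  constructor
  · intro hk d hd
    have : d.fst ∈ Subtype.val '' hπ.rotationSystem.faceVerts g := h ▸ ⟨d, hd, rfl⟩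
    obtain ⟨w, hw, hwd⟩ := this
    rw [← hwd]
    exact hk w hw
  · intro hk v hv
    have : v.1 ∈ {v | ∃ d ∈ T.bd (π ⁻¹' {hπ.part g}), d.fst = v} := h ▸ ⟨v, hv, rfl⟩
    obtain ⟨d, hd, hdv⟩ := this
    exact (congrArg c hdv).symm.trans (hk d hd)

/-- A partition of the faces of `T`, with a coloring of the parts, that exhibits `T` as a
quasi-Eulerian triangulation with respect to `f`, except that the contraction to which it leads
may have separating triangles.  The condition on the blue parts is that of the recursive
definition, expressed through colorings; by the last condition the parts are smaller than
the complement of `f`. -/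
structure Admissible (f : T.Face) (π : T.Face → T.Face) (ψ : T.Face → FaceColor) : Prop where
  triangularParts : TriangularParts π
  proper : ∀ d ∈ crossing π, ψ (π (T.face d)) ≠ ψ (π (T.face d.symm))
  eq_root : ∀ p, π p = π f → p = f
  root_red : ψ (π f) = FaceColor.red
  tight : ∀ p, ψ (π p) = FaceColor.blue → T.Tight (π ⁻¹' {π p})
  three_le : 3 ≤ (Set.range π).ncard

lemma tight_singleton (p : T.Face) : T.Tight {p} := by
  rintro c ⟨k, hk⟩
  refine ⟨p, rfl, k, ?_⟩
  rintro v ⟨d, hd, rfl⟩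
  exact hk d (by rw [T.isTriangular.bd_singleton]; exact hd)

lemma IsBarrier.exists_admissible (hcard : 3 ≤ Nat.card T.Face) {f : T.Face} {S : Set T.Face}
    {ι : Type*} {K : ι → Set T.Face} (hB : IsBarrier S K) (hf : neighborFaces f ⊆ S)
    (hf' : ∃ i, K i = {f}) : ∃ π ψ, Admissible f π ψ := by
  classical
  obtain ⟨i₀, hi₀⟩ := hf'
  choose rep hrep using hB.nonempty
  let π : T.Face → T.Face := fun p =>
    if h : p ∈ S then p else rep (Classical.choose (hB.exists_mem p h))
  have hπS : ∀ p ∈ S, π p = p := fun p hp => dif_pos hp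
  have hπK : ∀ i, ∀ p ∈ K i, π p = rep i := by
    intro i p hp
    have hpS := hB.notMem i p hp
    have h := Classical.choose_spec (hB.exists_mem p hpS)
    have hi := hB.eq_of_mem _ _ _ h hp
    change dite _ _ _ = _
    rw [dif_neg hpS, hi]
  have hrepS : ∀ i, rep i ∉ S := fun i => hB.notMem i _ (hrep i)
  have hcases : ∀ p, p ∈ S ∨ ∃ i, p ∈ K i := fun p => or_iff_not_imp_left.2 (hB.exists_mem p)
  have hfibS : ∀ p ∈ S, π ⁻¹' {π p} = {p} := by
    intro p hp
    ext q
    rw [Set.mem_preimage, Set.mem_singleton_iff, Set.mem_singleton_iff, hπS p hp]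
    constructor
    · intro h
      rcases hcases q with hq | ⟨i, hq⟩
      · rwa [hπS q hq] at h
      · rw [hπK i q hq] at h
        exact absurd (h ▸ hp) (hrepS i)
    · rintro rfl
      exact hπS q hp
  have hfibK : ∀ i, ∀ p ∈ K i, π ⁻¹' {π p} = K i := by
    intro i p hp
    ext q
    rw [Set.mem_preimage, Set.mem_singleton_iff, hπK i p hp]
    constructor
    · intro h
      rcases hcases q with hq | ⟨j, hq⟩
      · rw [hπS q hq] at h
        exact absurd (h ▸ hq) (hrepS i)
      · rw [hπK j q hq] at h
        have := hB.eq_of_mem i j (rep i) (hrep i) (h ▸ hrep j)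
        exact this ▸ hq
    · exact fun hq => hπK i q hq
  have hfi : f ∈ K i₀ := hi₀ ▸ rfl
  refine ⟨π, fun q => if q ∈ S then FaceColor.blue else FaceColor.red, ?_, ?_, ?_, ?_, ?_, ?_⟩
  · intro p
    rcases hcases p with hp | ⟨i, hp⟩
    · rw [hfibS p hp, T.isTriangular.ncard_bd_singleton]
    · rw [hfibK i p hp, hB.ncard_bd]
  · intro d hd
    rcases hcases (T.face d) with h | ⟨i, h⟩
    · obtain ⟨j, hj⟩ := hB.exists_symm_mem d h
      simp [hπS _ h, h, hπK j _ hj, hrepS j]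
    · have h' : T.face d.symm ∈ S := by
        refine hB.symm_mem i d ⟨h, fun h' => hd ?_⟩
        rw [hπK i _ h, hπK i _ h']
      simp [hπS _ h', h', hπK i _ h, hrepS i]
  · intro p hp
    have : p ∈ π ⁻¹' {π f} := hp
    rw [hfibK i₀ f hfi, hi₀] at this
    exact this
  · simp [hπK i₀ f hfi, hrepS i₀]
  · intro p hp
    rcases hcases p with h | ⟨i, h⟩
    · rw [hfibS p h]
      exact tight_singleton p
    · simp [hπK i p h, hrepS i] at hp
  · rw [← ncard_neighborFaces hcard f]
    refine Set.ncard_le_ncard ?_ (Set.toFinite _)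
    exact fun p hp => ⟨p, hπS p (hf hp)⟩

lemma TriangularParts.contract_proper {π : T.Face → T.Face} {ψ : T.Face → FaceColor}
    (hπ : TriangularParts π) (hne : Nonempty T.Face)
    (hψ : ∀ d ∈ crossing π, ψ (π (T.face d)) ≠ ψ (π (T.face d.symm))) :
    (hπ.contract hne).IsProperFaceColoring (fun g => ψ (hπ.part g)) := by
  intro x
  have h₁ : hπ.part ((hπ.contract hne).face x) = π (T.face (hπ.dart x).1) := hπ.part_face x
  have h₂ : hπ.part ((hπ.contract hne).face x.symm) = π (T.face (hπ.dart x).1.symm) := by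
    exact (hπ.part_face _).trans (congrArg (fun z => π (T.face z.1)) (hπ.dart_symm x))
  exact fun heq => hψ _ (hπ.dart x).2
    ((congrArg ψ h₁).symm.trans (heq.trans (congrArg ψ h₂)))

/-- If the contraction has a separating triangle, then the side of it that avoids the root can be
contracted further.  If the faces along the inner side of the triangle are blue, then the new
part is tight, by the count of monochromatic edges. -/
lemma Admissible.exists_ncard_lt {f : T.Face} {π : T.Face → T.Face} {ψ : T.Face → FaceColor}
    (h : Admissible f π ψ) {a b c : ContractVertex π}
    (hsep : (h.triangularParts.contract ⟨f⟩).IsSeparatingTriangle a b c) :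
    ∃ π' ψ', Admissible f π' ψ' ∧ (Set.range π').ncard < (Set.range π).ncard := by
  classical
  have hπ := h.triangularParts
  obtain ⟨r, hr⟩ := hπ.exists_part_eq f
  obtain ⟨A, hrA, hA, hAc, hbd⟩ := hsep.exists_side r
  have hψ := hπ.contract_proper (ψ := ψ) ⟨f⟩ h.proper
  obtain ⟨k, hk⟩ := hψ.exists_bd_color hbd
  set A' : Set T.Face := hπ.part '' A with hA'
  have hmemA : ∀ g, hπ.part g ∈ A' ↔ g ∈ A := fun g => hπ.part_injective.mem_set_image
  have hpre : hπ.part ⁻¹' A' = A := Set.ext hmemA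
  have himage := hπ.image_bd A'
  rw [hpre] at himage
  have hbdB : (T.bd (π ⁻¹' A')).ncard = 3 := by
    rw [← hπ.ncard_bd, hpre]
    exact hbd
  have hkB : ∀ d ∈ T.bd (π ⁻¹' A'), ψ (π (T.face d)) = k := by
    intro d hd
    rw [← himage] at hd
    obtain ⟨x, hx, rfl⟩ := hd
    have := hk x hx
    rw [← this]
    exact congrArg ψ (hπ.part_face x).symm
  obtain ⟨a₀, ha₀, a₁, ha₁, ha₀₁⟩ := hA
  obtain ⟨b₀, hb₀, b₁, hb₁, hb₀₁⟩ := hAc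
  have ha₀' : hπ.part a₀ ∈ A' := (hmemA a₀).2 ha₀
  let π' : T.Face → T.Face := fun p => if π p ∈ A' then hπ.part a₀ else π p
  let ψ' : T.Face → FaceColor := fun q => if q = hπ.part a₀ then k else ψ q
  have hin : ∀ p, π p ∈ A' → π' p = hπ.part a₀ := fun p hp => if_pos hp
  have hout : ∀ p, π p ∉ A' → π' p = π p := fun p hp => if_neg hp
  have hout_ne : ∀ p, π p ∉ A' → π p ≠ hπ.part a₀ := fun p hp hp' => hp (hp' ▸ ha₀')
  have hψin : ∀ p, π p ∈ A' → ψ' (π' p) = k := fun p hp => by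
    rw [hin p hp]
    exact if_pos rfl
  have hψout : ∀ p, π p ∉ A' → ψ' (π' p) = ψ (π p) := fun p hp => by
    rw [hout p hp]
    exact if_neg (hout_ne p hp)
  have hfibin : ∀ p, π p ∈ A' → π' ⁻¹' {π' p} = π ⁻¹' A' := by
    intro p hp
    ext q
    rw [Set.mem_preimage, Set.mem_singleton_iff, hin p hp, Set.mem_preimage]
    refine ⟨fun hq => ?_, hin q⟩
    by_contra hcon
    exact hout_ne q hcon ((hout q hcon).symm.trans hq)
  have hfibout : ∀ p, π p ∉ A' → π' ⁻¹' {π' p} = π ⁻¹' {π p} := by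
    intro p hp
    ext q
    rw [Set.mem_preimage, Set.mem_singleton_iff, hout p hp, Set.mem_preimage,
      Set.mem_singleton_iff]
    by_cases hq : π q ∈ A'
    · rw [hin q hq]
      exact ⟨fun h => absurd h.symm (hout_ne p hp), fun h => absurd (h ▸ hq) hp⟩
    · rw [hout q hq]
  have hf : π f ∉ A' := by
    rw [← hr, hmemA]
    exact hrA
  have hexp : ∀ g, ∃ p, π p = hπ.part g := hπ.exists_eq_part
  refine ⟨π', ψ', ⟨?_, ?_, ?_, ?_, ?_, ?_⟩, ?_⟩
  · intro p
    by_cases hp : π p ∈ A'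
    · rw [hfibin p hp, hbdB]
    · rw [hfibout p hp, hπ p]
  · have key : ∀ d, π (T.face d) ∈ A' → π (T.face d.symm) ∉ A' →
        ψ' (π' (T.face d)) ≠ ψ' (π' (T.face d.symm)) := by
      intro d hd hd'
      rw [hψin _ hd, hψout _ hd', ← hkB d ⟨hd, hd'⟩]
      exact h.proper d fun heq => hd' (heq ▸ hd)
    intro d hd
    by_cases h₁ : π (T.face d) ∈ A' <;> by_cases h₂ : π (T.face d.symm) ∈ A'
    · exact absurd ((hin _ h₁).trans (hin _ h₂).symm) hd
    · exact key d h₁ h₂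
    · have := key d.symm h₂ (by simpa using h₁)
      rw [SimpleGraph.Dart.symm_symm] at this
      exact this.symm
    · rw [hψout _ h₁, hψout _ h₂]
      refine h.proper d fun heq => hd ?_
      rw [hout _ h₁, hout _ h₂, heq]
  · intro p hp
    have : p ∈ π' ⁻¹' {π' f} := hp
    rw [hfibout f hf] at this
    exact h.eq_root p this
  · rw [hψout f hf]
    exact h.root_red
  · intro p hp
    by_cases hpA : π p ∈ A'
    · rw [hψin p hpA] at hp
      subst hp
      rw [hfibin p hpA]
      rintro c ⟨l, hl⟩
      have hfst : ∀ x ∈ (hπ.contract ⟨f⟩).bd A, c x.fst.1 = l := by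
        intro x hx
        refine (congrArg c (hπ.dart_fst x)).symm.trans (hl _ ?_)
        rw [← himage]
        exact ⟨x, hx, rfl⟩
      obtain ⟨g, hg, hgb, hgm⟩ := hψ.exists_blue_monochromatic hbd hk (c := fun v => c v.1)
        (by
          intro x hx
          obtain ⟨y, hy, hyx⟩ := exists_bd_succ hx
          rw [← hyx]
          exact (hfst x hx).trans (hfst y hy).symm)
      obtain ⟨q, hq⟩ := hexp g
      obtain ⟨t, ht, htm⟩ := h.tight q (by rw [hq]; exact hgb) c (by
        rw [hq]
        exact (hπ.isMonochromatic_iff ⟨f⟩ c g).1 hgm)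
      refine ⟨t, ?_, htm⟩
      have ht' : π t = π q := ht
      rw [Set.mem_preimage, ht', hq]
      exact (hmemA g).2 hg
    · rw [hfibout p hpA]
      rw [hψout p hpA] at hp
      exact h.tight p hp
  · have hne : ∀ g ∈ Aᶜ, hπ.part a₀ ≠ hπ.part g := fun g hg heq =>
      hg (hπ.part_injective heq ▸ ha₀)
    have h3 : ({hπ.part a₀, hπ.part b₀, hπ.part b₁} : Set T.Face).ncard = 3 :=
      Set.ncard_eq_three.2 ⟨_, _, _, hne b₀ hb₀, hne b₁ hb₁,
        fun heq => hb₀₁ (hπ.part_injective heq), rfl⟩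
    rw [← h3]
    refine Set.ncard_le_ncard ?_ (Set.toFinite _)
    have hb : ∀ g ∈ Aᶜ, hπ.part g ∈ Set.range π' := by
      intro g hg
      obtain ⟨p, hp⟩ := hexp g
      refine ⟨p, ?_⟩
      rw [hout p (by rw [hp]; exact fun hg' => hg ((hmemA g).1 hg')), hp]
    rintro q (rfl | rfl | rfl)
    · obtain ⟨p, hp⟩ := hexp a₀
      exact ⟨p, hin p (hp ▸ ha₀')⟩
    · exact hb b₀ hb₀
    · exact hb b₁ hb₁
  · refine Set.ncard_lt_ncard ⟨?_, ?_⟩ (Set.toFinite _)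
    · rintro _ ⟨p, rfl⟩
      by_cases hp : π p ∈ A'
      · rw [hin p hp]
        exact hexp a₀
      · rw [hout p hp]
        exact ⟨p, rfl⟩
    · intro hsub
      obtain ⟨p, hp⟩ := hsub (hexp a₁)
      by_cases hpA : π p ∈ A'
      · rw [hin p hpA] at hp
        exact ha₀₁ (hπ.part_injective hp)
      · rw [hout p hpA] at hp
        exact hpA (hp ▸ (hmemA a₁).2 ha₁)

/-- An admissible partition with the least number of parts leads to a contraction without
separating triangles. -/
lemma exists_admissible_of_tight (hcard : 3 ≤ Nat.card T.Face) {f : T.Face}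
    (hf : T.Tight {f}ᶜ) :
    ∃ (π : T.Face → T.Face) (ψ : T.Face → FaceColor) (h : Admissible f π ψ),
      ∀ a b c, ¬ (h.triangularParts.contract ⟨f⟩).IsSeparatingTriangle a b c := by
  classical
  have hex : ∃ n, ∃ π ψ, Admissible (T := T) f π ψ ∧ (Set.range π).ncard = n := by
    rcases exists_coloring_or_isBarrier hcard f with ⟨c, hc⟩ | ⟨S, ι, K, hB, hN, hi⟩
    · obtain ⟨p, hp, hpm⟩ := tight_compl_singleton.1 hf c ((hc f).2 rfl)
      exact absurd ((hc p).1 hpm) hp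
    · obtain ⟨π, ψ, h⟩ := hB.exists_admissible hcard hN hi
      exact ⟨_, π, ψ, h, rfl⟩
  obtain ⟨π, ψ, h, hn⟩ := Nat.find_spec hex
  refine ⟨π, ψ, h, fun a b c hsep => ?_⟩
  obtain ⟨π', ψ', h', hlt⟩ := h.exists_ncard_lt hsep
  exact Nat.find_min hex (hn ▸ hlt) ⟨π', ψ', h', rfl⟩

end PlaneTriangulation

/-! ### Pasting the pieces, and the lemma -/

namespace PlaneTriangulation

variable {V : Type u} [Finite V] {T : PlaneTriangulation V}

lemma exists_mem_bd_compl_iff {A : Set T.Face} {v : V} :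
    (∃ d ∈ T.bd Aᶜ, d.fst = v) ↔ ∃ d ∈ T.bd A, d.fst = v := by
  have key : ∀ A : Set T.Face, (∃ d ∈ T.bd Aᶜ, d.fst = v) → ∃ d ∈ T.bd A, d.fst = v := by
    rintro A ⟨d, hd, rfl⟩
    rw [bd_compl] at hd
    obtain ⟨e, he, rfl⟩ := hd
    exact exists_bd_succ he
  refine ⟨key A, fun h => key Aᶜ ?_⟩
  rwa [compl_compl]

open Classical in
/-- The map that contracts the complement of `A` to the face `r`. -/
noncomputable def collapse (A : Set T.Face) (r : T.Face) (p : T.Face) : T.Face :=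
  if p ∈ A then p else r

section

variable {A : Set T.Face} {r : T.Face}

lemma collapse_of_mem {p : T.Face} (hp : p ∈ A) : collapse A r p = p := if_pos hp

lemma collapse_of_notMem {p : T.Face} (hp : p ∉ A) : collapse A r p = r := if_neg hp

lemma preimage_collapse_of_mem (hr : r ∉ A) {p : T.Face} (hp : p ∈ A) :
    collapse A r ⁻¹' {p} = {p} := by
  ext q
  rw [Set.mem_preimage, Set.mem_singleton_iff, Set.mem_singleton_iff]
  by_cases hq : q ∈ A
  · rw [collapse_of_mem hq]
  · rw [collapse_of_notMem hq]
    exact ⟨fun h => absurd (h ▸ hp) hr, fun h => absurd (h ▸ hp) hq⟩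

lemma preimage_collapse_root (hr : r ∉ A) : collapse A r ⁻¹' {r} = Aᶜ := by
  ext q
  rw [Set.mem_preimage, Set.mem_singleton_iff, Set.mem_compl_iff]
  by_cases hq : q ∈ A
  · rw [collapse_of_mem hq]
    exact ⟨fun h => absurd (h ▸ hq) hr, fun h => absurd hq h⟩
  · exact ⟨fun _ => hq, fun _ => collapse_of_notMem hq⟩

lemma triangularParts_collapse (hA : (T.bd A).ncard = 3) (hr : r ∉ A) :
    TriangularParts (collapse A r) := by
  intro p
  by_cases hp : p ∈ A
  · rw [collapse_of_mem hp, preimage_collapse_of_mem hr hp, T.isTriangular.ncard_bd_singleton]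
  · rw [collapse_of_notMem hp, preimage_collapse_root hr, ncard_bd_compl, hA]

variable (hA : (T.bd A).ncard = 3) (hr : r ∉ A)

/-- The triangulation formed by the faces of `A` and one further face, which is the root. -/
noncomputable def sideTriangulation : RootedTriangulation.{u} where
  V := ContractVertex (collapse A r)
  tri := (triangularParts_collapse hA hr).contract ⟨r⟩
  root := ((triangularParts_collapse hA hr).exists_part_eq r).choose

/-- The face of `T` that corresponds to a face of `sideTriangulation`, the root being sent
to `r`. -/
noncomputable def sideFace (p : (sideTriangulation hA hr).tri.Face) : T.Face :=
  (triangularParts_collapse hA hr).part p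

/-- The inclusion of the vertices of `sideTriangulation`. -/
def sideIncl : (sideTriangulation hA hr).V ↪ V := ⟨Subtype.val, Subtype.val_injective⟩

lemma sideFace_injective : Function.Injective (sideFace hA hr) :=
  (triangularParts_collapse hA hr).part_injective

lemma sideFace_root : sideFace hA hr (sideTriangulation hA hr).root = r :=
  ((triangularParts_collapse hA hr).exists_part_eq r).choose_spec.trans (collapse_of_notMem hr)

lemma sideFace_mem {p : (sideTriangulation hA hr).tri.Face}
    (hp : p ≠ (sideTriangulation hA hr).root) : sideFace hA hr p ∈ A := by
  obtain ⟨q, hq⟩ := (triangularParts_collapse hA hr).exists_eq_part p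
  change collapse A r q = sideFace hA hr p at hq
  by_cases hqA : q ∈ A
  · rw [← hq, collapse_of_mem hqA]
    exact hqA
  · refine absurd (sideFace_injective hA hr ?_) hp
    rw [sideFace_root, ← hq, collapse_of_notMem hqA]

lemma exists_sideFace_eq {p : T.Face} (hp : p ∈ A) :
    ∃ q, q ≠ (sideTriangulation hA hr).root ∧ sideFace hA hr q = p := by
  obtain ⟨q, hq⟩ := (triangularParts_collapse hA hr).exists_part_eq p
  change sideFace hA hr q = collapse A r p at hq
  rw [collapse_of_mem hp] at hq
  refine ⟨q, ?_, hq⟩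
  rintro rfl
  rw [sideFace_root] at hq
  exact hr (hq ▸ hp)

lemma image_faceVerts_side {p : (sideTriangulation hA hr).tri.Face}
    (hp : p ≠ (sideTriangulation hA hr).root) :
    sideIncl hA hr '' (sideTriangulation hA hr).tri.faceVerts p =
      T.faceVerts (sideFace hA hr p) := by
  refine ((triangularParts_collapse hA hr).image_faceVerts p).trans ?_
  change {v | ∃ d ∈ T.bd (collapse A r ⁻¹' {sideFace hA hr p}), d.fst = v} = _
  rw [preimage_collapse_of_mem hr (sideFace_mem hA hr hp), T.isTriangular.bd_singleton]
  rfl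

lemma image_faceVerts_root :
    sideIncl hA hr '' (sideTriangulation hA hr).tri.faceVerts (sideTriangulation hA hr).root =
      {v | ∃ d ∈ T.bd A, d.fst = v} := by
  refine ((triangularParts_collapse hA hr).image_faceVerts _).trans ?_
  change {v | ∃ d ∈ T.bd (collapse A r ⁻¹' {sideFace hA hr _}), d.fst = v} = _
  rw [sideFace_root, preimage_collapse_root hr]
  ext v
  exact exists_mem_bd_compl_iff

lemma exists_face_mem_of_mem_range {v : V} (hv : v ∈ Set.range (sideIncl hA hr)) :
    ∃ d : T.graph.Dart, d.fst = v ∧ T.face d ∈ A := by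
  obtain ⟨⟨_, d, hd, rfl⟩, rfl⟩ := hv
  change ∃ e : T.graph.Dart, e.fst = d.fst ∧ T.face e ∈ A
  by_cases hdA : T.face d ∈ A
  · exact ⟨d, rfl, hdA⟩
  · refine ⟨T.rot d, T.rot_fst d, ?_⟩
    rw [face_rot]
    by_contra hdA'
    exact hd ((collapse_of_notMem hdA).trans (collapse_of_notMem hdA').symm)

lemma isMonochromatic_side (c : V → VertexColor) {p : (sideTriangulation hA hr).tri.Face}
    (hp : p ≠ (sideTriangulation hA hr).root) :
    (sideTriangulation hA hr).tri.IsMonochromatic (c ∘ sideIncl hA hr) p ↔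
      T.IsMonochromatic c (sideFace hA hr p) := by
  unfold IsMonochromatic
  rw [← image_faceVerts_side hA hr hp]
  simp

lemma tight_sideTriangulation (hT : T.Tight A) :
    (sideTriangulation hA hr).tri.Tight {(sideTriangulation hA hr).root}ᶜ := by
  rw [tight_compl_singleton]
  intro c ⟨k, hk⟩
  -- extend the coloring to all vertices of `T`
  obtain ⟨c', hc'⟩ : ∃ c' : V → VertexColor, c = c' ∘ sideIncl hA hr :=
    ⟨Function.extend (sideIncl hA hr) c fun _ => k,
      funext fun v => ((sideIncl hA hr).injective.extend_apply c _ v).symm⟩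
  subst hc'
  obtain ⟨p, hp, hpm⟩ := hT c' ⟨k, fun d hd => by
    have : d.fst ∈ {v | ∃ d ∈ T.bd A, d.fst = v} := ⟨d, hd, rfl⟩
    rw [← image_faceVerts_root hA hr] at this
    obtain ⟨w, hw, hwd⟩ := this
    rw [← hwd]
    exact hk w hw⟩
  obtain ⟨q, hq, rfl⟩ := exists_sideFace_eq hA hr hp
  exact ⟨q, hq, (isMonochromatic_side hA hr c' hq).2 hpm⟩

lemma card_face_side_lt (hAc : Aᶜ.Nontrivial) :
    Nat.card (sideTriangulation hA hr).tri.Face < Nat.card T.Face := by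
  have h₁ : Nat.card (sideTriangulation hA hr).tri.Face ≤ (insert r A).ncard := by
    rw [← Nat.card_coe_set_eq]
    refine Nat.card_le_card_of_injective (fun p => ⟨sideFace hA hr p, ?_⟩) fun p q h =>
      sideFace_injective hA hr (congrArg Subtype.val h)
    by_cases hp : p = (sideTriangulation hA hr).root
    · left
      rw [hp, sideFace_root]
    · exact Or.inr (sideFace_mem hA hr hp)
  refine h₁.trans_lt ?_
  rw [← Set.ncard_univ]
  refine Set.ncard_lt_ncard ?_ (Set.toFinite _)
  rw [Set.ssubset_univ_iff]
  intro h
  obtain ⟨q, hq, hqr⟩ := hAc.exists_ne r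
  have : q ∈ insert r A := h ▸ Set.mem_univ q
  exact this.elim hqr hq

end

section

variable {f : T.Face} {π : T.Face → T.Face} (hπ : TriangularParts π)
  (r : hπ.rotationSystem.Face) (hr : hπ.part r = π f)

lemma TriangularParts.ncard_bd_part (g : hπ.rotationSystem.Face) :
    (T.bd (π ⁻¹' {hπ.part g})).ncard = 3 := by
  obtain ⟨p, hp⟩ := hπ.exists_eq_part g
  rw [← hp]
  exact hπ p

lemma TriangularParts.notMem_part (hr : hπ.part r = π f) {g : hπ.rotationSystem.Face}
    (hg : g ≠ r) :
    f ∉ π ⁻¹' {hπ.part g} := fun h => hg (hπ.part_injective (Eq.trans (Eq.symm h) hr.symm))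

lemma TriangularParts.image_faceVerts_eq (hf : ∀ p, π p = π f → p = f)
    (r : hπ.rotationSystem.Face) (hr : hπ.part r = π f) :
    Subtype.val '' hπ.rotationSystem.faceVerts r = T.faceVerts f := by
  have h : π ⁻¹' {hπ.part r} = {f} := by
    ext p
    rw [hr]
    exact ⟨hf p, fun h => congrArg π h⟩
  rw [hπ.image_faceVerts, h, T.isTriangular.bd_singleton]
  rfl

variable (f) in
/-- The triangulation formed by the faces of the part contracted to `g`, and one further face. -/
noncomputable def TriangularParts.piece (hr : hπ.part r = π f)
    (g : {g : hπ.rotationSystem.Face | g ≠ r}) : RootedTriangulation.{u} :=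
  sideTriangulation (hπ.ncard_bd_part g.1) (hπ.notMem_part r hr g.2)

/-- The inclusion of the vertices of `TriangularParts.piece`. -/
def TriangularParts.pieceIncl (g : {g : hπ.rotationSystem.Face | g ≠ r}) :
    (hπ.piece f r hr g).V ↪ V :=
  sideIncl (hπ.ncard_bd_part g.1) (hπ.notMem_part r hr g.2)

/-- The face of `T` that corresponds to a face of `TriangularParts.piece`. -/
noncomputable def TriangularParts.pieceFace (g : {g : hπ.rotationSystem.Face | g ≠ r})
    (p : (hπ.piece f r hr g).tri.Face) : T.Face :=
  sideFace (hπ.ncard_bd_part g.1) (hπ.notMem_part r hr g.2) p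

lemma TriangularParts.glue (g : {g : hπ.rotationSystem.Face | g ≠ r}) :
    hπ.pieceIncl r hr g '' (hπ.piece f r hr g).tri.faceVerts (hπ.piece f r hr g).root =
      Subtype.val '' hπ.rotationSystem.faceVerts g.1 :=
  (image_faceVerts_root _ _).trans (hπ.image_faceVerts g.1).symm

lemma TriangularParts.inter_skeleton (g : {g : hπ.rotationSystem.Face | g ≠ r}) :
    Set.range (hπ.pieceIncl r hr g) ∩ Set.range (Subtype.val : ContractVertex π → V) =
      Subtype.val '' hπ.rotationSystem.faceVerts g.1 := by
  apply Set.Subset.antisymm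
  · rw [hπ.image_faceVerts]
    rintro v ⟨hv, ⟨_, e, he, rfl⟩, rfl⟩
    obtain ⟨d, hd, hdA⟩ := exists_face_mem_of_mem_range _ _ hv
    change d.fst = e.fst at hd
    change ∃ b ∈ T.bd _, b.fst = e.fst
    rw [← hd]
    by_cases heA : T.face e ∈ π ⁻¹' {hπ.part g.1}
    · refine exists_mem_bd_of_fst_eq (e := T.rot e) (hd.trans (T.rot_fst e).symm) hdA ?_
      rw [face_rot]
      exact fun h => he (Eq.trans heA (Eq.symm h))
    · exact exists_mem_bd_of_fst_eq hd hdA heA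
  · rw [Set.subset_inter_iff]
    refine ⟨?_, Set.image_subset_range _ _⟩
    rw [← hπ.glue r hr g]
    exact Set.image_subset_range _ _

lemma TriangularParts.inter_piece {g h : {g : hπ.rotationSystem.Face | g ≠ r}} (hgh : g ≠ h) :
    Set.range (hπ.pieceIncl r hr g) ∩ Set.range (hπ.pieceIncl r hr h) ⊆
      Set.range (Subtype.val : ContractVertex π → V) := by
  rintro v ⟨hv, hv'⟩
  obtain ⟨d, hd, hdA⟩ := exists_face_mem_of_mem_range _ _ hv
  obtain ⟨e, he, heA⟩ := exists_face_mem_of_mem_range _ _ hv'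
  obtain ⟨b, hb, hbv⟩ := exists_mem_bd_of_fst_eq (hd.trans he.symm) hdA (fun h' => hgh
    (Subtype.ext (hπ.part_injective (Eq.trans (Eq.symm h') heA))))
  exact ⟨⟨v, b, (mem_bd_fiber.1 hb).1, hbv.trans hd⟩, rfl⟩

variable (f) in
/-- The face `f`, onto which nothing is pasted, and the faces of the pieces other than their roots,
as faces of `T`. -/
noncomputable def TriangularParts.pasteFace (hr : hπ.part r = π f) :
    ({p : hπ.rotationSystem.Face // p ∉ {g : hπ.rotationSystem.Face | g ≠ r}} ⊕
      (Σ g : {g : hπ.rotationSystem.Face | g ≠ r},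
        {p : (hπ.piece f r hr g).tri.Face // p ≠ (hπ.piece f r hr g).root})) → T.Face :=
  Sum.elim (fun _ => f) fun x => hπ.pieceFace r hr x.1 x.2.1

lemma TriangularParts.part_pieceFace {g : {g : hπ.rotationSystem.Face | g ≠ r}}
    {p : (hπ.piece f r hr g).tri.Face} (hp : p ≠ (hπ.piece f r hr g).root) :
    π (hπ.pieceFace r hr g p) = hπ.part g.1 :=
  sideFace_mem _ _ hp

lemma TriangularParts.pieceFace_ne {g : {g : hπ.rotationSystem.Face | g ≠ r}}
    {p : (hπ.piece f r hr g).tri.Face} (hp : p ≠ (hπ.piece f r hr g).root) :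
    hπ.pieceFace r hr g p ≠ f := by
  intro h
  have := hπ.part_pieceFace r hr hp
  rw [h, ← hr] at this
  exact g.2 (hπ.part_injective this.symm)

lemma TriangularParts.pasteFace_bijective (hf : ∀ p, π p = π f → p = f) :
    Function.Bijective (hπ.pasteFace f r hr) := by
  constructor
  · rintro (⟨g, hg⟩ | ⟨g, p⟩) (⟨h, hh⟩ | ⟨h, q⟩) hxy
    · obtain rfl : g = r := not_not.1 hg
      obtain rfl : h = g := not_not.1 hh
      rfl
    · exact absurd (Eq.symm hxy) (hπ.pieceFace_ne r hr q.2)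
    · exact absurd hxy (hπ.pieceFace_ne r hr p.2)
    · have hxy' : hπ.pieceFace r hr g p.1 = hπ.pieceFace r hr h q.1 := hxy
      obtain rfl : g = h := Subtype.ext (hπ.part_injective (by
        rw [← hπ.part_pieceFace r hr p.2, hxy', hπ.part_pieceFace r hr q.2]))
      obtain rfl : p = q := Subtype.ext (sideFace_injective _ _ hxy')
      rfl
  · intro p
    by_cases hp : p = f
    · exact ⟨Sum.inl ⟨r, fun h => h rfl⟩, hp.symm⟩
    · obtain ⟨g, hg⟩ := hπ.exists_part_eq p
      have hgr : g ≠ r := by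
        rintro rfl
        exact hp (hf p (hg.symm.trans hr))
      obtain ⟨q, hq, hqp⟩ := exists_sideFace_eq (hπ.ncard_bd_part g)
        (hπ.notMem_part r hr hgr) (p := p) hg.symm
      exact ⟨Sum.inr ⟨⟨g, hgr⟩, ⟨q, hq⟩⟩, hqp⟩

/-- `T` arises from the contraction by pasting onto each face other than the root `r` the
triangulation formed by the faces of the corresponding part; if the part is a single face, then
this triangulation is `K₃`. -/
noncomputable def TriangularParts.pasting (hf : ∀ p, π p = π f → p = f) :
    Pasting T (hπ.contract ⟨f⟩) where
  pasted := {g | g ≠ r}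
  piece g := hπ.piece f r hr g
  incl := ⟨Subtype.val, Subtype.val_injective⟩
  pieceIncl g := hπ.pieceIncl r hr g
  glue g := hπ.glue r hr g
  inter_skeleton g := hπ.inter_skeleton r hr g
  inter_piece _ _ hgh := hπ.inter_piece r hr hgh
  faceEquiv := Equiv.ofBijective _ (hπ.pasteFace_bijective r hr hf)
  faceVerts_inl p := by
    have hp : p.1 = r := not_not.1 p.2
    rw [hp]
    exact (hπ.image_faceVerts_eq hf r hr).symm
  faceVerts_inr _ p := (image_faceVerts_side _ _ p.2).symm

end

/-- Nothing is pasted. -/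
noncomputable def emptyPasting (T : PlaneTriangulation V) : Pasting T T where
  pasted := ∅
  piece g := g.2.elim
  incl := Function.Embedding.refl V
  pieceIncl g := g.2.elim
  glue g := g.2.elim
  inter_skeleton g := g.2.elim
  inter_piece g := g.2.elim
  faceEquiv := Equiv.ofBijective (Sum.elim (fun p => p.1) fun x => x.1.2.elim) (by
    constructor
    · rintro (p | x) (q | y) h
      · exact congrArg Sum.inl (Subtype.ext h)
      · exact y.1.2.elim
      · exact x.1.2.elim
      · exact x.1.2.elim
    · exact fun p => ⟨Sum.inl ⟨p, id⟩, rfl⟩)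
  faceVerts_inl p := (Set.image_id _).symm
  faceVerts_inr g := g.2.elim

/-- The triangle `K₃` is quasi-Eulerian. -/
lemma quasiEulerianClass_of_card_lt (hcard : Nat.card T.Face < 3) (f : T.Face) (n : ℕ) :
    QuasiEulerianClass (n + 1) ⟨V, T, f⟩ := by
  classical
  have htwo : ∀ p q : T.Face, p ≠ f → q ≠ f → p = q := by
    intro p q hp hq
    by_contra hpq
    have h3 : ({p, q, f} : Set T.Face).ncard = 3 :=
      Set.ncard_eq_three.2 ⟨p, q, f, hpq, hp, hq, rfl⟩
    have := Set.ncard_le_ncard (Set.subset_univ ({p, q, f} : Set T.Face)) (Set.toFinite _)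
    rw [h3, Set.ncard_univ] at this
    omega
  have hψ : T.IsProperFaceColoring
      (fun p => if p = f then FaceColor.red else FaceColor.blue) := by
    intro d
    have hne := T.isTriangular.face_symm_ne d
    by_cases h₁ : T.face d = f
    · have h₂ : T.face d.symm ≠ f := h₁ ▸ hne
      simp [h₁, h₂]
    · by_cases h₂ : T.face d.symm = f
      · simp [h₁, h₂]
      · exact absurd (htwo _ _ h₂ h₁) hne
  refine ⟨⟨V, T, f⟩, _, emptyPasting T, hψ.eulerian, ?_, hψ, if_pos rfl, ⟨id, rfl⟩,
    fun g => g.2.elim⟩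
  intro a b c hsep
  obtain ⟨A, hfA, ⟨p, hp, q, hq, hpq⟩, -⟩ := hsep.exists_side f
  exact hpq (htwo p q (fun h => hfA (h ▸ hp)) (fun h => hfA (h ▸ hq)))

/-- If every coloring in which `f` is monochromatic has another monochromatic face, then `T` is
quasi-Eulerian with respect to `f`. -/
lemma quasiEulerianClass_of_tight (n : ℕ) : ∀ {V : Type u} [Finite V] (T : PlaneTriangulation V)
    (f : T.Face), Nat.card T.Face ≤ n → T.Tight {f}ᶜ → QuasiEulerianClass n ⟨V, T, f⟩ := by
  induction n with
  | zero =>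
    intro V _ T f hn
    have : Nonempty T.Face := ⟨f⟩
    exact absurd hn (Nat.card_pos (α := T.Face)).not_ge
  | succ n ih =>
    intro V _ T f hn hf
    by_cases hcard : Nat.card T.Face < 3
    · exact quasiEulerianClass_of_card_lt hcard f n
    obtain ⟨π, ψ, h, hsep⟩ := exists_admissible_of_tight (not_lt.1 hcard) hf
    have hπ := h.triangularParts
    obtain ⟨r, hr⟩ := hπ.exists_part_eq f
    have hψ := hπ.contract_proper (ψ := ψ) ⟨f⟩ h.proper
    refine ⟨⟨ContractVertex π, hπ.contract ⟨f⟩, r⟩, fun g => ψ (hπ.part g),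
      hπ.pasting r hr h.eq_root, hψ.eulerian, hsep, hψ, ?_, ⟨fun h => h rfl, rfl⟩, ?_⟩
    · change ψ (hπ.part r) = _
      rw [hr]
      exact h.root_red
    · rintro ⟨g, hg⟩ hgb
      refine ih _ _ (Nat.lt_succ_iff.1 (lt_of_lt_of_le
        (card_face_side_lt (hπ.ncard_bd_part g) (hπ.notMem_part r hr hg) ?_) hn))
        (tight_sideTriangulation (hπ.ncard_bd_part g) (hπ.notMem_part r hr hg) ?_)
      · -- the other parts contain at least two faces
        by_contra hcon
        rw [Set.not_nontrivial_iff] at hcon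
        have hsub : Set.range π ⊆ {hπ.part g, π f} := by
          rintro _ ⟨p, rfl⟩
          by_cases hp : π p = hπ.part g
          · exact Or.inl hp
          · exact Or.inr (congrArg π (hcon hp (hπ.notMem_part r hr hg)))
        have h₁ := Set.ncard_le_ncard hsub (Set.toFinite _)
        have h₂ := Set.ncard_insert_le (hπ.part g) {π f}
        rw [Set.ncard_singleton] at h₂
        have h₃ := h.three_le
        omega
      · obtain ⟨p, hp⟩ := hπ.exists_eq_part g
        have hgb' : ψ (hπ.part g) = FaceColor.blue := hgb
        change T.Tight (π ⁻¹' {hπ.part g})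
        rw [← hp] at hgb' ⊢
        exact h.tight p hgb'

lemma quasiEulerian_iff_tight (T : PlaneTriangulation V) (f : T.Face) :
    T.QuasiEulerian f ↔ T.Tight {f}ᶜ :=
  ⟨fun ⟨_, h⟩ => h.tight, fun h => ⟨_, quasiEulerianClass_of_tight _ T f le_rfl h⟩⟩

/-- Exchanging the two colors, if necessary, a coloring that makes `f` monochromatic can be
arranged to have a prescribed color on `f`. -/
lemma exists_coloring_extending {f : T.Face} {c : V → VertexColor} (hc : T.IsMonochromatic c f)
    {c₀ : T.faceVerts f → VertexColor} (hc₀ : ∃ k, ∀ v, c₀ v = k) :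
    ∃ c' : V → VertexColor, (∀ v : T.faceVerts f, c' v = c₀ v) ∧
      ∀ p, T.IsMonochromatic c' p ↔ T.IsMonochromatic c p := by
  classical
  obtain ⟨k, hk⟩ := hc₀
  obtain ⟨l, hl⟩ := hc
  refine ⟨fun v => Equiv.swap k l (c v), fun v => ?_, fun p => ?_⟩
  · simp only
    rw [hl v.1 v.2, hk v, Equiv.swap_apply_right]
  · simp [isMonochromatic_iff]

end PlaneTriangulation

open PlaneTriangulation in
theorem lemma2p7 {V : Type u} [Finite V] (T : PlaneTriangulation V) (f : T.Face) :
    (∀ c₀ : T.faceVerts f → VertexColor, (∃ k, ∀ v, c₀ v = k) →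
      ((∃ c : V → VertexColor, (∀ v : T.faceVerts f, c v = c₀ v) ∧ T.IsNearWeak c) ↔
        ¬ T.QuasiEulerian f)) ∧
    (T.QuasiEulerian f →
      ∀ c₀ : T.faceVerts f → VertexColor, (∃ k, ∀ v, c₀ v = k) →
        ∃ c : V → VertexColor, (∀ v : T.faceVerts f, c v = c₀ v) ∧
          (T.monochromaticFaces c).ncard = 2) := by
  rw [T.quasiEulerian_iff_tight, tight_compl_singleton]
  refine ⟨fun c₀ hc₀ => ?_, fun htight c₀ hc₀ => ?_⟩
  · constructor
    · rintro ⟨c, hc, hnw⟩ htight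
      have hcf : T.IsMonochromatic c f := by
        obtain ⟨k, hk⟩ := hc₀
        exact ⟨k, fun v hv => (hc ⟨v, hv⟩).trans (hk _)⟩
      obtain ⟨p, hp, hpm⟩ := htight c hcf
      obtain ⟨q, hq⟩ := Set.ncard_eq_one.1 hnw
      have h₁ : f ∈ T.monochromaticFaces c := hcf
      have h₂ : p ∈ T.monochromaticFaces c := hpm
      rw [hq] at h₁ h₂
      exact hp (Eq.trans h₂ (Eq.symm h₁))
    · intro hnot
      push Not at hnot
      obtain ⟨c, hcf, hc⟩ := hnot
      obtain ⟨c', hc', hiff⟩ := exists_coloring_extending hcf hc₀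
      refine ⟨c', hc', Set.ncard_eq_one.2 ⟨f, Set.ext fun p => (hiff p).trans ⟨fun hp => ?_, ?_⟩⟩⟩
      · by_contra hpf
        exact hc p hpf hp
      · rintro rfl
        exact hcf
  · -- it suffices to find a coloring in which `f` is one of exactly two monochromatic faces
    suffices h : ∃ (c : V → VertexColor) (g : T.Face), g ≠ f ∧
        ∀ p, T.IsMonochromatic c p ↔ p = f ∨ p = g by
      obtain ⟨c, g, hgf, hc⟩ := h
      obtain ⟨c', hc', hiff⟩ := exists_coloring_extending ((hc f).2 (Or.inl rfl)) hc₀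
      refine ⟨c', hc', Set.ncard_eq_two.2 ⟨f, g, hgf.symm, Set.ext fun p => ?_⟩⟩
      exact (hiff p).trans (hc p)
    by_cases hcard : 3 ≤ Nat.card T.Face
    · obtain ⟨c, hc | ⟨g, hgf, hc⟩⟩ := exists_coloring_le_two hcard f
      · obtain ⟨p, hp, hpm⟩ := htight c ((hc f).2 rfl)
        exact absurd ((hc p).1 hpm) hp
      · exact ⟨c, g, hgf, hc⟩
    · -- with at most two faces, all faces are monochromatic in a constant coloring
      have hconst : ∀ p, T.IsMonochromatic (fun _ => VertexColor.black) p :=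
        fun p => ⟨VertexColor.black, fun _ _ => rfl⟩
      obtain ⟨g, hgf, -⟩ := htight _ (hconst f)
      refine ⟨_, g, hgf, fun p => ⟨fun _ => ?_, fun _ => hconst p⟩⟩
      by_contra! hp
      have h3 : ({p, f, g} : Set T.Face).ncard = 3 :=
        Set.ncard_eq_three.2 ⟨p, f, g, hp.1, hp.2, hgf.symm, rfl⟩
      have := Set.ncard_le_ncard (Set.subset_univ ({p, f, g} : Set T.Face)) (Set.toFinite _)
      rw [h3, Set.ncard_univ] at this
      exact hcard this
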